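/- Conventions. Let $A$ be a unital $C^*$-algebra. Hilbert $A$-modules are complete right modules with $A$-valued inner product that is $A$-linear in the second variable. A correspondence $M$ over $A$ is a Hilbert $A$-module with a left action of $A$ by adjointable operators; it is assumed essential, i.e. $1\cdot m=m$ for all $m\in M$. $X\otimes_A M$ is the internal tensor product: the Hilbert module completion of $X\odot M$ for $\langle x\otimes m,y\otimes n\rangle=\langle\langle y,x\rangle\cdot m,n\rangle$. A countable family $(x_i)$ in a submodule $V$ of a Hilbert module is a Parseval frame for $V$ if $\langle y,y\rangle=\sum_i\langle y,x_i\rangle\langle x_i,y\rangle$ for all $y\in V$, with unconditional norm convergence. It is an orthonormal basis for $V$ if $\langle x_i,x_j\rangle=\delta_{ij}1$ and $V$ is contained in the closed $A$-submodule generated by the $x_i$. Let $m\in M$ with $\langle m,m\rangle=1$. Then $M_\infty$, with canonical maps $\iota^k:M^{\otimes k}\to M_\infty$, denotes the Hilbert-module direct limit of $A\to M\to M^{\otimes 2}\to\cdots$ with respect to the inner-product preserving maps $n\mapsto m\otimes n$ (and $a\mapsto m\cdot a$ for $k=0$), where $M^{\otimes 0}=A$ and $A\otimes_AM^{\otimes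 k}$ is identified with $M^{\otimes k}$. A scaling function for $m$ is a triple $(X,D,\phi)$ in which $X$ is a Hilbert $A$-module, $D:X\to X\otimes_AM$ is an isomorphism of Hilbert modules, and $\phi\in X$ satisfies $\langle\phi,\phi\rangle=1$ and $D\phi=\phi\otimes m$. The powers of $D$ are the isomorphisms $D^k:X\to X\otimes_AM^{\otimes k}$ given by $D^0=\mathrm{id}$, $D^{k+1}=(D^k\otimes\mathrm{id})\circ D$; and $D^{-k}=(D^k)^{-1}$. **Theorem.** (1) Let $M$ be an essential correspondence over the unital $C^*$-algebra $A$, let $\{m_j:j\ge 0\}$ be a finite or countably infinite Parseval frame for $M$ with $\langle m_0,m_0\rangle=1$, and let $(X,D,\phi)$ be a scaling function for $m_0$. Form $M_\infty$ with respect to $m_0$. There are a unique isomorphism $R:M_\infty\to M_\infty\otimes_AM$ and a unique inner-product preserving module map $Q:M_\infty\to X$ such that $R\circ\iota^{k+1}=\iota^k\otimes\mathrm{id}$ for $k\ge 0$, $Q(\iota^0(1))=\phi$ and $D\circ Q=(Q\otimes\mathrm{id})\circ R$. Moreover $$\{\phi\}\cup\big\{D^{-k}(\phi\otimes m_{j_1}\otimes\cdots\otimes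 m_{j_k}) : k\ge 1,\ j_l\ge 0,\ j_1>0\big\}$$ is a Parseval frame for $Q(M_\infty)$. If $\{m_j\}$ is orthonormal, it is an orthonormal basis for $Q(M_\infty)$. (2) Let $C$ be a compact Hausdorff space and $\sigma:C\to C$ a surjective local homeomorphism. Let $A=C(C)$, $\alpha(f)=f\circ\sigma$ and $L(f)(c)=|\sigma^{-1}(c)|^{-1}\sum_{\sigma(d)=c}f(d)$. Let $M_L$ be the correspondence obtained by completing $C(C)$ with the right action $m\cdot a=m\,\alpha(a)$, the left action by multiplication and the inner product $\langle m,n\rangle=L(m^*n)$. (The underlying space of $M_L$ is $C(C)$.) Let $m_j\in C(C)$ $(j\ge0)$ be a finite or countably infinite family that is a Parseval frame for $M_L$, with $\langle m_0,m_0\rangle=1$ in $M_L$. Let $X$ be a Hilbert $C(C)$-module, let $\phi\in X$ satisfy $\langle\phi,\phi\rangle=1$, and let $D:X\to X$ be a linear isomorphism such that $$D(x\cdot f)=(Dx)\cdot\alpha(f),\qquad L(\langle Dx,Dy\rangle)=\langle x,y\rangle,\qquad D\phi=\phi\cdot m_0 .$$ Write $(M_L)_\infty$ for the module $M_\infty$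 formed from $M=M_L$ and $m=m_0$. There are a unique linear isomorphism $R$ of $(M_L)_\infty$ onto itself and a unique inner-product preserving module map $Q:(M_L)_\infty\to X$ such that $R(x\cdot f)=(Rx)\cdot\alpha(f)$, $L(\langle Rx,Ry\rangle)=\langle x,y\rangle$, $R(\iota^{k+1}(z\otimes a))=\iota^k(z)\cdot a$ for $k\ge 0$, $z\in M_L^{\otimes k}$ and $a\in C(C)$, $Q(\iota^0(1))=\phi$ and $D\circ Q=Q\circ R$. Moreover $$\{\phi\}\cup\Big\{D^{-k}\Big(\phi\cdot\prod_{l=1}^k\alpha^{l-1}(m_{j_l})\Big) : k\ge 1,\ j_l\ge 0,\ j_1>0\Big\}$$ is a Parseval frame for $Q((M_L)_\infty)$. If $\{m_j\}$ is orthonormal in $M_L$, it is an orthonormal basis for $Q((M_L)_\infty)$. -/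

import Mathlib

open scoped RightActions TensorProduct ComplexOrder

universe u

noncomputable section

/-- A (complete) right Hilbert `A`-module. The inner product is `A`-valued, conjugate linear in the
first variable, linear in the second, and `⟨x, y · a⟩ = ⟨x, y⟩ a`; the right action is encoded as an
action of `Aᵐᵒᵖ`, so that `x <• a` is `x · a`. Definiteness of the inner product is part of
`norm_eq`. -/
structure RightHilbertModule (A : Type u) [CStarAlgebra A] [PartialOrder A] where
  carrier : Type u
  [normedAddCommGroup : NormedAddCommGroup carrier]
  [normedSpace : NormedSpace ℂ carrier]
  [completeSpace : CompleteSpace carrier]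
  [module : Module Aᵐᵒᵖ carrier]
  [isScalarTower : IsScalarTower ℂ Aᵐᵒᵖ carrier]
  inner : carrier → carrier → A
  inner_add_right : ∀ x y z, inner x (y + z) = inner x y + inner x z
  inner_smul_right : ∀ x y (a : A), inner x (y <• a) = inner x y * a
  star_inner : ∀ x y, star (inner x y) = inner y x
  inner_self_nonneg : ∀ x, 0 ≤ inner x x
  norm_eq : ∀ x, ‖x‖ = √‖inner x x‖

instance (A : Type u) [CStarAlgebra A] [PartialOrder A] :
    CoeSort (RightHilbertModule A) (Type u) := ⟨RightHilbertModule.carrier⟩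

attribute [instance] RightHilbertModule.normedAddCommGroup RightHilbertModule.normedSpace
  RightHilbertModule.completeSpace RightHilbertModule.module RightHilbertModule.isScalarTower

/-- A correspondence over the unital C*-algebra `A` that is essential as a left module: a right
Hilbert `A`-module with a unital left action of `A` by adjointable operators, `a ↦ (x ↦ a • x)`
being a `*`-homomorphism. -/
structure CStarCorrespondence (A : Type u) [CStarAlgebra A] [PartialOrder A] extends
    RightHilbertModule A where
  [leftModule : Module A carrier]
  [leftIsScalarTower : IsScalarTower ℂ A carrier]
  inner_left_smul : ∀ (a : A) x y, inner (a • x) y = inner x (star a • y)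

instance (A : Type u) [CStarAlgebra A] [PartialOrder A] :
    CoeSort (CStarCorrespondence A) (Type u) := ⟨fun M => M.carrier⟩

attribute [instance] CStarCorrespondence.leftModule CStarCorrespondence.leftIsScalarTower

/-- An inner-product preserving map of Hilbert modules. -/
structure InnerMap {A : Type u} [CStarAlgebra A] [PartialOrder A]
    (X Y : RightHilbertModule A) extends X →ₗ[Aᵐᵒᵖ] Y where
  inner_map : ∀ x y, Y.inner (toFun x) (toFun y) = X.inner x y

/-- An isomorphism of Hilbert modules. -/
structure InnerEquiv {A : Type u} [CStarAlgebra A] [PartialOrder A]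
    (X Y : RightHilbertModule A) extends X ≃ₗ[Aᵐᵒᵖ] Y where
  inner_map : ∀ x y, Y.inner (toFun x) (toFun y) = X.inner x y

section PreHilbert

/-- An `A`-valued semi-inner product on a right `A`-module. -/
structure PreHilbertModule (A E : Type u) [CStarAlgebra A] [PartialOrder A] [AddCommGroup E]
    [Module ℂ E] [Module Aᵐᵒᵖ E] [IsScalarTower ℂ Aᵐᵒᵖ E] where
  inner : E → E → A
  inner_add_right : ∀ x y z, inner x (y + z) = inner x y + inner x z
  inner_smul_right : ∀ x y (a : A), inner x (y <• a) = inner x y * a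
  star_inner : ∀ x y, star (inner x y) = inner y x
  inner_self_nonneg : ∀ x, 0 ≤ inner x x

namespace PreHilbertModule

variable {A E : Type u} [CStarAlgebra A] [PartialOrder A] [AddCommGroup E]
  [Module ℂ E] [Module Aᵐᵒᵖ E] [IsScalarTower ℂ Aᵐᵒᵖ E] (P : PreHilbertModule A E)

lemma inner_add_left (x y z : E) : P.inner (x + y) z = P.inner x z + P.inner y z := by
  rw [← P.star_inner z, P.inner_add_right, star_add, P.star_inner, P.star_inner]

lemma inner_smul_left (x y : E) (a : A) : P.inner (x <• a) y = star a * P.inner x y := by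
  rw [← P.star_inner y, P.inner_smul_right, star_mul, P.star_inner]

lemma complex_smul_eq (c : ℂ) (x : E) : c • x = x <• (c • (1 : A)) := by
  rw [MulOpposite.op_smul, smul_assoc, MulOpposite.op_one, one_smul]

lemma inner_csmul_right (x y : E) (c : ℂ) : P.inner x (c • y) = c • P.inner x y := by
  rw [complex_smul_eq (A := A), P.inner_smul_right, mul_smul_comm, mul_one]

lemma inner_csmul_left (x y : E) (c : ℂ) : P.inner (c • x) y = star c • P.inner x y := by
  rw [← P.star_inner y, P.inner_csmul_right, star_smul, P.star_inner]

lemma inner_zero_right (x : E) : P.inner x 0 = 0 := by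
  simpa using P.inner_csmul_right x 0 0

lemma inner_zero_left (x : E) : P.inner 0 x = 0 := by
  simpa using P.inner_csmul_left 0 x 0

lemma inner_neg_right (x y : E) : P.inner x (-y) = -P.inner x y := by
  simpa using P.inner_csmul_right x y (-1)

lemma inner_neg_left (x y : E) : P.inner (-x) y = -P.inner x y := by
  simpa using P.inner_csmul_left x y (-1)

lemma inner_sub_right (x y z : E) : P.inner x (y - z) = P.inner x y - P.inner x z := by
  rw [sub_eq_add_neg, P.inner_add_right, P.inner_neg_right, sub_eq_add_neg]

lemma inner_sub_left (x y z : E) : P.inner (x - y) z = P.inner x z - P.inner y z := by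
  rw [sub_eq_add_neg, P.inner_add_left, P.inner_neg_left, sub_eq_add_neg]

lemma inner_sum_right {ι : Type*} (s : Finset ι) (x : E) (f : ι → E) :
    P.inner x (∑ i ∈ s, f i) = ∑ i ∈ s, P.inner x (f i) := by
  classical
  induction s using Finset.induction_on with
  | empty => simp [P.inner_zero_right]
  | insert i s hi ih => rw [Finset.sum_insert hi, Finset.sum_insert hi, P.inner_add_right, ih]

lemma inner_sum_left {ι : Type*} (s : Finset ι) (x : E) (f : ι → E) :
    P.inner (∑ i ∈ s, f i) x = ∑ i ∈ s, P.inner (f i) x := by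
  rw [← P.star_inner, P.inner_sum_right, star_sum]
  simp only [P.star_inner]

variable [StarOrderedRing A]

lemma norm_inner_sq_le (x y : E) : ‖P.inner x y‖ ^ 2 ≤ ‖P.inner x x‖ * ‖P.inner y y‖ := by
  have key : ∀ t : ℝ, ‖P.inner x x‖ < t → ‖P.inner x y‖ ^ 2 ≤ t * ‖P.inner y y‖ := by
    intro t ht
    have ht0 : 0 < t := (norm_nonneg _).trans_lt ht
    set a := P.inner x y with ha
    have h0 := P.inner_self_nonneg (x <• a - (t : ℂ) • y)
    have hyx : P.inner y x = star a := by rw [ha, P.star_inner]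
    have e1 : P.inner (x <• a - (t : ℂ) • y) (x <• a - (t : ℂ) • y)
        = star a * P.inner x x * a - (2 * t) • (star a * a) + (t * t) • P.inner y y := by
      simp only [inner_sub_left, inner_sub_right, inner_smul_left, inner_smul_right,
        inner_csmul_left, inner_csmul_right, hyx, ← ha, Complex.star_def, Complex.conj_ofReal,
        sub_mul, smul_sub, smul_mul_assoc, mul_assoc]
      simp only [Complex.coe_smul, two_mul, add_smul, mul_smul]
      abel
    have e2 : star a * P.inner x x * a ≤ t • (star a * a) := by
      have hs : IsSelfAdjoint (P.inner x x) := P.star_inner x x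
      refine (CStarAlgebra.star_left_conjugate_le_norm_smul (a := a) hs).trans ?_
      exact smul_le_smul_of_nonneg_right ht.le (star_mul_self_nonneg a)
    have e3 : t • (star a * a) ≤ (t * t) • P.inner y y := by
      rw [e1] at h0
      have : (0 : A) ≤ t • (star a * a) - (2 * t) • (star a * a) + (t * t) • P.inner y y := by
        refine h0.trans ?_
        gcongr
      have h3 : t • (star a * a) - (2 * t) • (star a * a) = - (t • (star a * a)) := by
        rw [← sub_smul, ← neg_smul]; congr 1; ring
      rw [h3, neg_add_eq_sub, sub_nonneg] at this
      exact this
    have e4 := CStarAlgebra.norm_le_norm_of_nonneg_of_le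
      (smul_nonneg ht0.le (star_mul_self_nonneg a)) e3
    rw [norm_smul, norm_smul, CStarRing.norm_star_mul_self, Real.norm_of_nonneg ht0.le,
      Real.norm_of_nonneg (by positivity)] at e4
    have : t * ‖a‖ ^ 2 ≤ t * (t * ‖P.inner y y‖) := by nlinarith
    exact le_of_mul_le_mul_left this ht0
  have hc : Filter.Tendsto (fun t : ℝ => t * ‖P.inner y y‖)
      (nhdsWithin ‖P.inner x x‖ (Set.Ioi ‖P.inner x x‖)) (nhds (‖P.inner x x‖ * ‖P.inner y y‖)) :=
    ((continuous_id.mul continuous_const).tendsto _).mono_left nhdsWithin_le_nhds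
  exact ge_of_tendsto hc (Filter.eventually_of_mem self_mem_nhdsWithin key)

lemma norm_inner_le (x y : E) : ‖P.inner x y‖ ≤ √‖P.inner x x‖ * √‖P.inner y y‖ := by
  rw [← Real.sqrt_mul (norm_nonneg _)]
  exact Real.le_sqrt_of_sq_le (P.norm_inner_sq_le x y)

/-- The underlying space of a pre-Hilbert module, seminormed by `‖x‖ = ‖⟨x, x⟩‖^{1/2}`. -/
def Space (_ : PreHilbertModule A E) : Type u := E

instance : AddCommGroup P.Space := inferInstanceAs (AddCommGroup E)
instance : Module ℂ P.Space := inferInstanceAs (Module ℂ E)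
instance : Module Aᵐᵒᵖ P.Space := inferInstanceAs (Module Aᵐᵒᵖ E)
instance : IsScalarTower ℂ Aᵐᵒᵖ P.Space := inferInstanceAs (IsScalarTower ℂ Aᵐᵒᵖ E)

/-- The semi-inner product, on the seminormed space. -/
def onSpace : PreHilbertModule A P.Space where
  inner := P.inner
  inner_add_right := P.inner_add_right
  inner_smul_right := P.inner_smul_right
  star_inner := P.star_inner
  inner_self_nonneg := P.inner_self_nonneg

/-- The inner product on the underlying space. -/
def ip (x y : P.Space) : A := P.onSpace.inner x y

instance : Norm P.Space := ⟨fun x => √‖P.ip x x‖⟩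

lemma norm_def (x : P.Space) : ‖x‖ = √‖P.ip x x‖ := rfl

lemma norm_ip_le (x y : P.Space) : ‖P.ip x y‖ ≤ ‖x‖ * ‖y‖ := P.norm_inner_le x y

lemma norm_sq_eq (x : P.Space) : ‖x‖ ^ 2 = ‖P.ip x x‖ := Real.sq_sqrt (norm_nonneg _)

lemma core : SeminormedSpace.Core ℂ P.Space where
  norm_nonneg _ := Real.sqrt_nonneg _
  norm_smul c x := by
    rw [norm_def, norm_def, ip, ip, P.onSpace.inner_csmul_left, P.onSpace.inner_csmul_right, smul_smul, norm_smul,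
      norm_mul, norm_star, Real.sqrt_mul (by positivity), Real.sqrt_mul_self (norm_nonneg _)]
  norm_triangle x y := by
    have hx : 0 ≤ ‖x‖ := Real.sqrt_nonneg _
    have hy : 0 ≤ ‖y‖ := Real.sqrt_nonneg _
    refine Real.sqrt_le_iff.2 ⟨by positivity, ?_⟩
    have e : P.ip (x + y) (x + y) = P.ip x x + P.ip x y + (P.ip y x + P.ip y y) := by
      unfold ip
      rw [P.onSpace.inner_add_left, P.onSpace.inner_add_right, P.onSpace.inner_add_right]
    rw [e]
    have h1 := P.norm_sq_eq x
    have h2 := P.norm_sq_eq y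
    have h3 := P.norm_ip_le x y
    have h4 := P.norm_ip_le y x
    have h5 := norm_add_le (P.ip x x + P.ip x y) (P.ip y x + P.ip y y)
    have h6 := norm_add_le (P.ip x x) (P.ip x y)
    have h7 := norm_add_le (P.ip y x) (P.ip y y)
    nlinarith

instance : SeminormedAddCommGroup P.Space := SeminormedAddCommGroup.ofCore P.core
instance : NormedSpace ℂ P.Space where
  norm_smul_le c x := (P.core.norm_smul c x).le

lemma norm_op_smul_le (a : A) (x : P.Space) : ‖x <• a‖ ≤ ‖a‖ * ‖x‖ := by
  have h : ‖x <• a‖ ^ 2 ≤ (‖a‖ * ‖x‖) ^ 2 := by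
    have e : P.ip (x <• a) (x <• a) = star a * (P.ip x x * a) := by
      unfold ip
      rw [P.onSpace.inner_smul_left, P.onSpace.inner_smul_right]
    rw [P.norm_sq_eq, e, mul_pow, P.norm_sq_eq]
    refine (norm_mul_le _ _).trans ?_
    rw [norm_star]
    have := norm_mul_le (P.ip x x) a
    nlinarith [norm_nonneg a]
  exact le_of_sq_le_sq h (by positivity)

lemma uniformContinuousConstSMul_of_bound {R : Type*} [Monoid R] [DistribMulAction R P.Space]
    (h : ∀ r : R, ∃ C : ℝ, ∀ x : P.Space, ‖r • x‖ ≤ C * ‖x‖) :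
    UniformContinuousConstSMul R P.Space where
  uniformContinuous_const_smul r := by
    obtain ⟨C, hC⟩ := h r
    exact (AddMonoidHomClass.lipschitz_of_bound (DistribSMul.toAddMonoidHom P.Space r) C
      hC).uniformContinuous

instance : UniformContinuousConstSMul Aᵐᵒᵖ P.Space :=
  P.uniformContinuousConstSMul_of_bound fun r => ⟨‖r.unop‖, fun x => P.norm_op_smul_le r.unop x⟩

open UniformSpace

lemma continuous_ip : Continuous fun p : P.Space × P.Space => P.ip p.1 p.2 := by
  rw [continuous_iff_continuousAt]
  rintro ⟨x, y⟩
  rw [ContinuousAt, tendsto_iff_norm_sub_tendsto_zero]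
  have hb : ∀ p : P.Space × P.Space, ‖P.ip p.1 p.2 - P.ip x y‖ ≤
      ‖p.1 - x‖ * ‖p.2‖ + ‖x‖ * ‖p.2 - y‖ := by
    intro p
    have e : P.ip p.1 p.2 - P.ip x y = P.ip (p.1 - x) p.2 + P.ip x (p.2 - y) := by
      unfold ip
      rw [P.onSpace.inner_sub_left, P.onSpace.inner_sub_right]
      abel
    rw [e]
    exact (norm_add_le _ _).trans (add_le_add (P.norm_ip_le _ _) (P.norm_ip_le _ _))
  have hc : Filter.Tendsto (fun p : P.Space × P.Space => ‖p.1 - x‖ * ‖p.2‖ + ‖x‖ * ‖p.2 - y‖)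
      (nhds (x, y)) (nhds (‖x - x‖ * ‖y‖ + ‖x‖ * ‖y - y‖)) := by
    have : Continuous (fun p : P.Space × P.Space => ‖p.1 - x‖ * ‖p.2‖ + ‖x‖ * ‖p.2 - y‖) := by
      fun_prop
    exact this.tendsto (x, y)
  simp only [sub_self, norm_zero, zero_mul, mul_zero, add_zero] at hc
  exact squeeze_zero (fun _ => norm_nonneg _) hb hc

/-- The extension of the inner product to the completion by continuity. -/
def cip (x y : Completion P.Space) : A :=
  (Completion.isDenseInducing_coe.prodMap Completion.isDenseInducing_coe).extend
    (fun p : P.Space × P.Space => P.ip p.1 p.2) (x, y)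

@[simp] lemma cip_coe (x y : P.Space) :
    P.cip (x : Completion P.Space) (y : Completion P.Space) = P.ip x y :=
  (Completion.isDenseInducing_coe.prodMap Completion.isDenseInducing_coe).extend_eq
    P.continuous_ip (x, y)

lemma continuous_cip :
    Continuous fun p : Completion P.Space × Completion P.Space => P.cip p.1 p.2 := by
  let ip' : P.Space →+ P.Space →+ A :=
    AddMonoidHom.mk' (fun x => AddMonoidHom.mk' (fun y => P.ip x y) (P.inner_add_right x))
      (fun x y => by ext z; exact P.inner_add_left x y z)
  have h : Continuous fun p : P.Space × P.Space => ip' p.1 p.2 := P.continuous_ip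
  exact (Completion.isDenseInducing_toCompl P.Space).extend_Z_bilin
    (Completion.isDenseInducing_toCompl P.Space) h

lemma _root_.Continuous.cip {α : Type*} [TopologicalSpace α] {f g : α → Completion P.Space}
    (hf : Continuous f) (hg : Continuous g) : Continuous fun x => P.cip (f x) (g x) :=
  P.continuous_cip.comp (hf.prodMk hg)

lemma cip_add_right (x y z : Completion P.Space) : P.cip x (y + z) = P.cip x y + P.cip x z := by
  refine Completion.induction_on₃ x y z (isClosed_eq ?_ ?_) fun x y z => ?_
  · exact Continuous.cip P continuous_fst (continuous_snd.fst.add continuous_snd.snd)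
  · exact (Continuous.cip P continuous_fst continuous_snd.fst).add
      (Continuous.cip P continuous_fst continuous_snd.snd)
  · rw [← Completion.coe_add, cip_coe, cip_coe, cip_coe]
    exact P.inner_add_right x y z

lemma cip_smul_right (x y : Completion P.Space) (a : A) : P.cip x (y <• a) = P.cip x y * a := by
  refine Completion.induction_on₂ x y (isClosed_eq ?_ ?_) fun x y => ?_
  · exact Continuous.cip P continuous_fst
      ((continuous_const_smul (MulOpposite.op a)).comp continuous_snd)
  · exact (Continuous.cip P continuous_fst continuous_snd).mul continuous_const
  · rw [← Completion.coe_smul, cip_coe, cip_coe]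
    exact P.inner_smul_right x y a

lemma star_cip (x y : Completion P.Space) : star (P.cip x y) = P.cip y x := by
  refine Completion.induction_on₂ x y (isClosed_eq ?_ ?_) fun x y => ?_
  · exact (Continuous.cip P continuous_fst continuous_snd).star
  · exact Continuous.cip P continuous_snd continuous_fst
  · rw [cip_coe, cip_coe]
    exact P.star_inner x y

lemma cip_self_nonneg (x : Completion P.Space) : 0 ≤ P.cip x x := by
  refine Completion.induction_on x (isClosed_le continuous_const ?_) fun x => ?_
  · exact Continuous.cip P continuous_id continuous_id
  · rw [cip_coe]
    exact P.inner_self_nonneg x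

lemma norm_eq_cip (x : Completion P.Space) : ‖x‖ = √‖P.cip x x‖ := by
  refine Completion.induction_on x (isClosed_eq continuous_norm ?_) fun x => ?_
  · exact (Continuous.cip P continuous_id continuous_id).norm.sqrt
  · rw [Completion.norm_coe, cip_coe, norm_def]

/-- The Hilbert module obtained from a pre-Hilbert module by completing (which also divides out the
vectors of length zero). -/
def completion : RightHilbertModule A where
  carrier := Completion P.Space
  inner := P.cip
  inner_add_right := P.cip_add_right
  inner_smul_right := P.cip_smul_right
  star_inner := P.star_cip
  inner_self_nonneg := P.cip_self_nonneg
  norm_eq := P.norm_eq_cip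

/-- The canonical map of a pre-Hilbert module into its completion. -/
def of : E →ₗ[Aᵐᵒᵖ] P.completion where
  toFun x := ((show P.Space from x : P.Space) : Completion P.Space)
  map_add' _ _ := Completion.coe_add _ _
  map_smul' a x := Completion.coe_smul a (show P.Space from x)

lemma inner_of (x y : E) : P.completion.inner (P.of x) (P.of y) = P.inner x y := P.cip_coe x y

end PreHilbertModule

end PreHilbert

namespace RightHilbertModule

variable {A : Type u} [CStarAlgebra A] [PartialOrder A]

/-- The inner product of a Hilbert module, regarded as a semi-inner product. -/
def pre (X : RightHilbertModule A) : PreHilbertModule A X where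
  inner := X.inner
  inner_add_right := X.inner_add_right
  inner_smul_right := X.inner_smul_right
  star_inner := X.star_inner
  inner_self_nonneg := X.inner_self_nonneg

/-- The free rank-one Hilbert module `A_A`, with `⟨a, b⟩ = a* b`. -/
def self (A : Type u) [CStarAlgebra A] [PartialOrder A] [StarOrderedRing A] :
    RightHilbertModule A where
  carrier := A
  inner a b := star a * b
  inner_add_right _ _ _ := mul_add _ _ _
  inner_smul_right _ _ _ := (mul_assoc _ _ _).symm
  star_inner _ _ := by rw [star_mul, star_star]
  inner_self_nonneg _ := star_mul_self_nonneg _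
  norm_eq x := by rw [CStarRing.norm_star_mul_self, Real.sqrt_mul_self (norm_nonneg _)]

lemma exists_posPart_negPart {B : Type*} [NonUnitalCStarAlgebra B] [PartialOrder B]
    [StarOrderedRing B] (G : B) (hG : IsSelfAdjoint G) :
    ∃ N R T : B, G = star T * T - N ∧ star N = N ∧ star T * T * N = 0 ∧ N = star R * R := by
  obtain ⟨T, hT⟩ := CStarAlgebra.nonneg_iff_eq_star_mul_self.1 (CFC.posPart_nonneg G)
  obtain ⟨R, hR⟩ := CStarAlgebra.nonneg_iff_eq_star_mul_self.1 (CFC.negPart_nonneg G)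
  refine ⟨G⁻, R, T, ?_, (CFC.negPart_nonneg G).isSelfAdjoint, ?_, hR⟩
  · rw [← hT, CFC.posPart_sub_negPart G hG]
  · rw [← hT, CFC.posPart_mul_negPart]

/-- The Gram matrix of a finite family in a Hilbert module is a positive matrix over `A`. -/
lemma exists_gram [StarOrderedRing A] (X : RightHilbertModule A) {ι : Type*} [Fintype ι]
    [DecidableEq ι] (x : ι → X) :
    ∃ B : ι → ι → A, ∀ i j, X.inner (x i) (x j) = ∑ k, star (B k i) * B k j := by
  let G : CStarMatrix ι ι A := CStarMatrix.ofMatrix (Matrix.of fun i j => X.inner (x i) (x j))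
  have hG : IsSelfAdjoint G := by
    ext i j
    exact X.star_inner _ _
  obtain ⟨N, R, T, hGN, hNs, hTN, hR⟩ := exists_posPart_negPart G hG
  have hGN' : G * N = -(N * N) := by
    rw [hGN, sub_mul, hTN, zero_sub]
  have h3 : star N * (G * N) = - (star (R * N) * (R * N)) := by
    rw [hGN', hNs, star_mul, hNs, mul_assoc N (star R), ← mul_assoc (star R), ← hR, mul_neg]
  have hdiag : ∀ k, 0 ≤ (star N * (G * N)) k k := by
    intro k
    have e : (star N * (G * N)) k k
        = X.inner (∑ i, x i <• (N i k)) (∑ j, x j <• (N j k)) := by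
      change _ = X.pre.inner _ _
      simp only [PreHilbertModule.inner_sum_right, PreHilbertModule.inner_sum_left,
        PreHilbertModule.inner_smul_left, PreHilbertModule.inner_smul_right, Finset.sum_mul]
      rw [Finset.sum_comm]
      change ∑ i, star (N i k) * (∑ j, X.inner (x i) (x j) * N j k) = _
      refine Finset.sum_congr rfl fun i _ => ?_
      rw [Finset.mul_sum]
      exact Finset.sum_congr rfl fun j _ => (mul_assoc _ _ _).symm
    rw [e]
    exact X.inner_self_nonneg _
  have hzero : R * N = 0 := by
    ext l k
    have h1 : (0 : A) ≤ - ∑ l, star ((R * N) l k) * (R * N) l k := by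
      have := hdiag k
      rw [h3] at this
      exact this
    have h2 : ∑ l, star ((R * N) l k) * (R * N) l k = 0 :=
      le_antisymm (neg_nonneg.1 h1) (Finset.sum_nonneg fun l _ => star_mul_self_nonneg _)
    have h4 := (Finset.sum_eq_zero_iff_of_nonneg
      (fun l _ => star_mul_self_nonneg ((R * N) l k))).1 h2 l (Finset.mem_univ _)
    exact CStarRing.star_mul_self_eq_zero_iff _ |>.1 h4
  have hN : N = 0 := by
    refine CStarRing.star_mul_self_eq_zero_iff _ |>.1 ?_
    rw [hNs]
    nth_rw 1 [hR]
    rw [mul_assoc, hzero, mul_zero]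
  rw [hN, sub_zero] at hGN
  exact ⟨T, fun i j => congrArg (fun S : CStarMatrix ι ι A => S i j) hGN⟩

end RightHilbertModule

section InnerMap

variable {A : Type u} [CStarAlgebra A] [PartialOrder A] {X Y Z : RightHilbertModule A}

namespace InnerMap

instance : FunLike (InnerMap X Y) X Y where
  coe f := f.toLinearMap
  coe_injective := by
    rintro ⟨f, hf⟩ ⟨g, hg⟩ h
    congr
    exact DFunLike.coe_injective h

instance : LinearMapClass (InnerMap X Y) Aᵐᵒᵖ X Y where
  map_add f := f.toLinearMap.map_add
  map_smulₛₗ f := f.toLinearMap.map_smul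

@[ext] lemma ext {f g : InnerMap X Y} (h : ∀ x, f x = g x) : f = g := DFunLike.ext _ _ h

lemma inner_apply (f : InnerMap X Y) (x y : X) : Y.inner (f x) (f y) = X.inner x y :=
  f.inner_map x y

lemma map_complex_smul (f : InnerMap X Y) (c : ℂ) (x : X) : f (c • x) = c • f x := by
  rw [PreHilbertModule.complex_smul_eq (A := A) c x, map_smul,
    PreHilbertModule.complex_smul_eq (A := A) c (f x)]

/-- The identity map. -/
def id (X : RightHilbertModule A) : InnerMap X X where
  toLinearMap := LinearMap.id
  inner_map _ _ := rfl

/-- Composition of inner-product preserving maps. -/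
def comp (g : InnerMap Y Z) (f : InnerMap X Y) : InnerMap X Z where
  toLinearMap := g.toLinearMap.comp f.toLinearMap
  inner_map x y := (g.inner_map _ _).trans (f.inner_map x y)

@[simp] lemma id_apply (x : X) : id X x = x := rfl

@[simp] lemma comp_apply (g : InnerMap Y Z) (f : InnerMap X Y) (x : X) :
    g.comp f x = g (f x) := rfl

end InnerMap

namespace InnerEquiv

instance : EquivLike (InnerEquiv X Y) X Y where
  coe f := f.toLinearEquiv
  inv f := f.toLinearEquiv.symm
  left_inv f := f.toLinearEquiv.left_inv
  right_inv f := f.toLinearEquiv.right_inv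
  coe_injective' := by
    rintro ⟨f, hf⟩ ⟨g, hg⟩ h _
    congr
    exact DFunLike.coe_injective h

@[ext] lemma ext {f g : InnerEquiv X Y} (h : ∀ x, f x = g x) : f = g := DFunLike.ext _ _ h

/-- The underlying inner-product preserving map of an isomorphism. -/
def toInnerMap (f : InnerEquiv X Y) : InnerMap X Y where
  toLinearMap := f.toLinearEquiv.toLinearMap
  inner_map := f.inner_map

@[simp] lemma toInnerMap_apply (f : InnerEquiv X Y) (x : X) : f.toInnerMap x = f x := rfl

/-- The identity isomorphism. -/
def refl (X : RightHilbertModule A) : InnerEquiv X X where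
  toLinearEquiv := LinearEquiv.refl _ _
  inner_map _ _ := rfl

/-- The inverse isomorphism. -/
def symm (f : InnerEquiv X Y) : InnerEquiv Y X where
  toLinearEquiv := f.toLinearEquiv.symm
  inner_map x y := by
    have h := f.inner_map (f.toLinearEquiv.symm x) (f.toLinearEquiv.symm y)
    have e : ∀ z, f.toFun (f.toLinearEquiv.symm z) = z := f.toLinearEquiv.apply_symm_apply
    rw [e, e] at h
    exact h.symm

/-- Composition of isomorphisms: `f.trans g = g ∘ f`. -/
def trans (f : InnerEquiv X Y) (g : InnerEquiv Y Z) : InnerEquiv X Z where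
  toLinearEquiv := f.toLinearEquiv.trans g.toLinearEquiv
  inner_map x y := (g.inner_map _ _).trans (f.inner_map x y)

@[simp] lemma refl_apply (x : X) : refl X x = x := rfl

@[simp] lemma trans_apply (f : InnerEquiv X Y) (g : InnerEquiv Y Z) (x : X) :
    f.trans g x = g (f x) := rfl

@[simp] lemma apply_symm_apply (f : InnerEquiv X Y) (y : Y) : f (f.symm y) = y :=
  f.toLinearEquiv.apply_symm_apply y

@[simp] lemma symm_apply_apply (f : InnerEquiv X Y) (x : X) : f.symm (f x) = x :=
  f.toLinearEquiv.symm_apply_apply x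

end InnerEquiv

end InnerMap

namespace PreHilbertModule

open UniformSpace

variable {A E F : Type u} [CStarAlgebra A] [PartialOrder A] [StarOrderedRing A]
  [AddCommGroup E] [Module ℂ E] [Module Aᵐᵒᵖ E] [IsScalarTower ℂ Aᵐᵒᵖ E]
  [AddCommGroup F] [Module ℂ F] [Module Aᵐᵒᵖ F] [IsScalarTower ℂ Aᵐᵒᵖ F]
  {P : PreHilbertModule A E} {Q : PreHilbertModule A F}

/-- A module map of pre-Hilbert modules that preserves the inner products, as a map of the
seminormed spaces. -/
def spaceMap (f : E →ₗ[Aᵐᵒᵖ] F) : P.Space →ₗ[Aᵐᵒᵖ] Q.Space := f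

lemma uniformContinuous_spaceMap (f : E →ₗ[Aᵐᵒᵖ] F)
    (hf : ∀ x y, Q.inner (f x) (f y) = P.inner x y) :
    UniformContinuous (spaceMap f : P.Space →ₗ[Aᵐᵒᵖ] Q.Space) := by
  refine (AddMonoidHomClass.lipschitz_of_bound (spaceMap f : P.Space →ₗ[Aᵐᵒᵖ] Q.Space) 1
    fun x => ?_).uniformContinuous
  have e : Q.ip (spaceMap f x) (spaceMap f x) = P.ip x x := hf x x
  rw [one_mul, norm_def, norm_def, e]

section

variable (f : E →ₗ[Aᵐᵒᵖ] F)

lemma map_spaceMap_add (hu : UniformContinuous (spaceMap f : P.Space →ₗ[Aᵐᵒᵖ] Q.Space))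
    (x y : Completion P.Space) :
    Completion.map (spaceMap f : P.Space →ₗ[Aᵐᵒᵖ] Q.Space) (x + y) =
      Completion.map (spaceMap f : P.Space →ₗ[Aᵐᵒᵖ] Q.Space) x +
      Completion.map (spaceMap f : P.Space →ₗ[Aᵐᵒᵖ] Q.Space) y := by
  have hc : Continuous (Completion.map (spaceMap f : P.Space →ₗ[Aᵐᵒᵖ] Q.Space)) :=
    Completion.continuous_map
  refine Completion.induction_on₂ x y (isClosed_eq ?_ ?_) fun x y => ?_
  · exact hc.comp (continuous_fst.add continuous_snd)
  · exact (hc.comp continuous_fst).add (hc.comp continuous_snd)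
  · rw [← Completion.coe_add, Completion.map_coe hu, Completion.map_coe hu,
      Completion.map_coe hu, map_add, Completion.coe_add]

lemma map_spaceMap_smul (hu : UniformContinuous (spaceMap f : P.Space →ₗ[Aᵐᵒᵖ] Q.Space))
    (a : Aᵐᵒᵖ) (x : Completion P.Space) :
    Completion.map (spaceMap f : P.Space →ₗ[Aᵐᵒᵖ] Q.Space) (a • x) =
      a • Completion.map (spaceMap f : P.Space →ₗ[Aᵐᵒᵖ] Q.Space) x := by
  refine Completion.induction_on x (isClosed_eq ?_ ?_) fun x => ?_
  · exact Completion.continuous_map.comp (continuous_const_smul a)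
  · exact (continuous_const_smul a).comp Completion.continuous_map
  · rw [← Completion.coe_smul, Completion.map_coe hu, Completion.map_coe hu, map_smul,
      Completion.coe_smul]

lemma cip_map_spaceMap (hf : ∀ x y, Q.inner (f x) (f y) = P.inner x y)
    (hu : UniformContinuous (spaceMap f : P.Space →ₗ[Aᵐᵒᵖ] Q.Space))
    (x y : Completion P.Space) :
    Q.cip (Completion.map (spaceMap f : P.Space →ₗ[Aᵐᵒᵖ] Q.Space) x)
      (Completion.map (spaceMap f : P.Space →ₗ[Aᵐᵒᵖ] Q.Space) y) = P.cip x y := by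
  refine Completion.induction_on₂ x y (isClosed_eq ?_ ?_) fun x y => ?_
  · exact Continuous.cip Q (Completion.continuous_map.comp continuous_fst)
      (Completion.continuous_map.comp continuous_snd)
  · exact Continuous.cip P continuous_fst continuous_snd
  · rw [Completion.map_coe hu, Completion.map_coe hu, cip_coe, cip_coe]
    exact hf x y

end

/-- The extension to the completions of an inner-product preserving module map. -/
def completionMap (f : E →ₗ[Aᵐᵒᵖ] F) (hf : ∀ x y, Q.inner (f x) (f y) = P.inner x y) :
    InnerMap P.completion Q.completion where
  toFun := Completion.map (spaceMap f : P.Space →ₗ[Aᵐᵒᵖ] Q.Space)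
  map_add' := map_spaceMap_add f (uniformContinuous_spaceMap f hf)
  map_smul' := map_spaceMap_smul f (uniformContinuous_spaceMap f hf)
  inner_map := cip_map_spaceMap f hf (uniformContinuous_spaceMap f hf)

lemma completionMap_of (f : E →ₗ[Aᵐᵒᵖ] F) (hf : ∀ x y, Q.inner (f x) (f y) = P.inner x y)
    (x : E) : completionMap f hf (P.of x) = Q.of (f x) :=
  Completion.map_coe (uniformContinuous_spaceMap (P := P) (Q := Q) f hf) x

lemma completion_ext {Y : RightHilbertModule A} {f g : InnerMap P.completion Y}
    (h : ∀ x, f (P.of x) = g (P.of x)) : f = g := by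
  have hcont : ∀ f : InnerMap P.completion Y, Continuous (f : P.completion → Y) := fun f =>
    (AddMonoidHomClass.lipschitz_of_bound f 1 fun x => by
      rw [one_mul, Y.norm_eq, P.completion.norm_eq, f.inner_apply]).continuous
  have hcl : IsClosed {x : Completion P.Space | (f : P.completion → Y) x = g x} :=
    isClosed_eq (hcont f) (hcont g)
  exact InnerMap.ext fun x => Completion.induction_on (α := P.Space) x hcl h

end PreHilbertModule

section Tensor

variable {A : Type u} [CStarAlgebra A] [PartialOrder A]

namespace CStarCorrespondence

lemma inner_right_smul (M : CStarCorrespondence A) (a : A) (x y : M) :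
    M.inner x (a • y) = M.inner (star a • x) y := by
  rw [M.inner_left_smul, star_star]

end CStarCorrespondence

namespace RightHilbertModule

variable (X : RightHilbertModule A) (M : CStarCorrespondence A)

/-- For fixed `m` and `x`, the functional `n ⊗ y ↦ ⟨m, ⟨x, y⟩ • n⟩`. -/
def tensorFunctional (m : M) (x : X) : M ⊗[ℂ] X →ₗ[ℂ] A :=
  TensorProduct.lift <| LinearMap.mk₂ ℂ (fun (n : M) (y : X) => M.inner m (X.inner x y • n))
    (fun n n' y => by rw [smul_add, M.inner_add_right])
    (fun c n y => by
      rw [smul_comm]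
      exact M.pre.inner_csmul_right _ _ _)
    (fun n y y' => by rw [X.inner_add_right, add_smul, M.inner_add_right])
    (fun c n y => by
      have h : X.inner x (c • y) = c • X.inner x y := X.pre.inner_csmul_right _ _ _
      rw [h, smul_assoc]
      exact M.pre.inner_csmul_right _ _ _)

@[simp] lemma tensorFunctional_tmul (m n : M) (x y : X) :
    X.tensorFunctional M m x (n ⊗ₜ y) = M.inner m (X.inner x y • n) := rfl

/-- The sesquilinear form `(m ⊗ x, n ⊗ y) ↦ ⟨m, ⟨x, y⟩ • n⟩`. -/
def tensorForm : M ⊗[ℂ] X →ₗ⋆[ℂ] M ⊗[ℂ] X →ₗ[ℂ] A :=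
  TensorProduct.lift <| LinearMap.mk₂'ₛₗ (starRingEnd ℂ) (starRingEnd ℂ)
    (fun (m : M) (x : X) => X.tensorFunctional M m x)
    (fun m m' x => TensorProduct.ext' fun n y => M.pre.inner_add_left _ _ _)
    (fun c m x => TensorProduct.ext' fun n y => M.pre.inner_csmul_left _ _ _)
    (fun m x x' => TensorProduct.ext' fun n y => by
      have h : X.inner (x + x') y = X.inner x y + X.inner x' y := X.pre.inner_add_left _ _ _
      rw [LinearMap.add_apply, tensorFunctional_tmul, tensorFunctional_tmul, tensorFunctional_tmul,
        h, add_smul, M.inner_add_right])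
    (fun c m x => TensorProduct.ext' fun n y => by
      have h : X.inner (c • x) y = star c • X.inner x y := X.pre.inner_csmul_left _ _ _
      rw [LinearMap.smul_apply, tensorFunctional_tmul, tensorFunctional_tmul, h, smul_assoc]
      exact M.pre.inner_csmul_right _ _ _)

@[simp] lemma tensorForm_tmul (m n : M) (x y : X) :
    X.tensorForm M (m ⊗ₜ x) (n ⊗ₜ y) = M.inner m (X.inner x y • n) := rfl

lemma tensorForm_smul_right (z w : M ⊗[ℂ] X) (a : A) :
    X.tensorForm M z (w <• a) = X.tensorForm M z w * a := by
  induction z using TensorProduct.induction_on with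
  | zero => simp
  | add z z' hz hz' => rw [map_add, LinearMap.add_apply, LinearMap.add_apply, hz, hz', add_mul]
  | tmul m x =>
    induction w using TensorProduct.induction_on with
    | zero => simp
    | add w w' hw hw' => rw [smul_add, map_add, map_add, hw, hw', add_mul]
    | tmul n y =>
      rw [TensorProduct.smul_tmul', tensorForm_tmul, tensorForm_tmul, M.inner_right_smul,
        M.inner_smul_right, M.inner_right_smul]

lemma star_tensorForm (z w : M ⊗[ℂ] X) :
    star (X.tensorForm M z w) = X.tensorForm M w z := by
  induction z using TensorProduct.induction_on with
  | zero => simp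
  | add z z' hz hz' => rw [map_add, LinearMap.add_apply, star_add, map_add, hz, hz']
  | tmul m x =>
    induction w using TensorProduct.induction_on with
    | zero => simp
    | add w w' hw hw' => rw [map_add, map_add, LinearMap.add_apply, star_add, hw, hw']
    | tmul n y =>
      rw [tensorForm_tmul, tensorForm_tmul, M.star_inner, M.inner_left_smul, X.star_inner]

variable [StarOrderedRing A]

lemma tensorForm_self_nonneg (z : M ⊗[ℂ] X) : 0 ≤ X.tensorForm M z z := by
  classical
  obtain ⟨S, hS⟩ := TensorProduct.exists_finset z
  obtain ⟨B, hB⟩ := X.exists_gram (fun i : S => i.1.2)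
  have e : X.tensorForm M z z = ∑ k : S, M.inner (∑ i : S, B k i • i.1.1)
      (∑ j : S, B k j • j.1.1) := by
    have hr : ∀ k : S, M.inner (∑ i : S, B k i • i.1.1) (∑ j : S, B k j • j.1.1)
        = ∑ i : S, ∑ j : S, M.inner i.1.1 ((star (B k i) * B k j) • j.1.1) := by
      intro k
      change M.pre.inner _ _ = _
      rw [M.pre.inner_sum_left]
      refine Finset.sum_congr rfl fun i _ => ?_
      rw [M.pre.inner_sum_right]
      refine Finset.sum_congr rfl fun j _ => ?_
      change M.inner _ _ = _
      rw [M.inner_left_smul, smul_smul]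
    have hz : z = ∑ i : S, i.1.1 ⊗ₜ[ℂ] i.1.2 := by
      rw [hS, ← Finset.sum_coe_sort S (fun i => i.1 ⊗ₜ[ℂ] i.2)]
    simp only [hr]
    rw [Finset.sum_comm, hz]
    simp only [map_sum, LinearMap.sum_apply]
    rw [Finset.sum_comm]
    refine Finset.sum_congr rfl fun i _ => ?_
    rw [Finset.sum_comm]
    refine Finset.sum_congr rfl fun j _ => ?_
    rw [tensorForm_tmul, hB, Finset.sum_smul]
    exact M.pre.inner_sum_right _ _ _
  rw [e]
  exact Finset.sum_nonneg fun k _ => M.inner_self_nonneg _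

/-- The algebraic tensor product `X ⊙ M` with the semi-inner product
`⟨x ⊗ m, y ⊗ n⟩ = ⟨m, ⟨x, y⟩ • n⟩ = ⟨⟨y, x⟩ • m, n⟩`. The factors are written in the order `M ⊗[ℂ] X`
so that the right action `(x ⊗ m) · a = x ⊗ (m · a)` is the one on the first factor. -/
def tensorPre : PreHilbertModule A (M ⊗[ℂ] X) where
  inner z w := X.tensorForm M z w
  inner_add_right z w w' := map_add _ w w'
  inner_smul_right := X.tensorForm_smul_right M
  star_inner := X.star_tensorForm M
  inner_self_nonneg := X.tensorForm_self_nonneg M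

/-- The internal tensor product `X ⊗_A M`. -/
def tensor : RightHilbertModule A := (X.tensorPre M).completion

variable {X M}

/-- The elementary tensor `x ⊗ m` in `X ⊗_A M`. -/
def tmul (x : X) (m : M) : X.tensor M := (X.tensorPre M).of (m ⊗ₜ x)

lemma inner_tmul (x y : X) (m n : M) :
    (X.tensor M).inner (tmul x m) (tmul y n) = M.inner (X.inner y x • m) n := by
  rw [M.inner_left_smul, X.star_inner]
  exact (X.tensorPre M).inner_of _ _

lemma tmul_smul (x : X) (m : M) (a : A) :
    (tmul x (m <• a) : X.tensor M) = tmul x m <• a :=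
  ((X.tensorPre M).of.map_smul (MulOpposite.op a) (m ⊗ₜ x)).symm ▸ rfl

/-- Two inner-product preserving maps on `X ⊗_A M` that agree on elementary tensors are equal. -/
lemma tensor_ext {Z : RightHilbertModule A} {f g : InnerMap (X.tensor M) Z}
    (h : ∀ x m, f (tmul x m) = g (tmul x m)) : f = g := by
  refine PreHilbertModule.completion_ext fun z => ?_
  induction z using TensorProduct.induction_on with
  | zero => rw [map_zero]; exact (map_zero f).trans (map_zero g).symm
  | add _ _ hz hw =>
    rw [map_add]
    exact (map_add f _ _).trans ((congrArg₂ _ hz hw).trans (map_add g _ _).symm)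
  | tmul m x => exact h x m

end RightHilbertModule

variable [StarOrderedRing A] {X Y Z : RightHilbertModule A}

namespace InnerMap

lemma tensorForm_map (f : InnerMap X Y) (M : CStarCorrespondence A) (z w : M ⊗[ℂ] X) :
    Y.tensorForm M (TensorProduct.AlgebraTensorModule.map (LinearMap.id : M →ₗ[Aᵐᵒᵖ] M)
        ((f : X →ₗ[Aᵐᵒᵖ] Y).restrictScalars ℂ) z)
      (TensorProduct.AlgebraTensorModule.map (LinearMap.id : M →ₗ[Aᵐᵒᵖ] M)
        ((f : X →ₗ[Aᵐᵒᵖ] Y).restrictScalars ℂ) w) = X.tensorForm M z w := by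
  induction z using TensorProduct.induction_on with
  | zero => simp
  | add z z' hz hz' => rw [map_add, map_add, map_add, LinearMap.add_apply, LinearMap.add_apply,
      hz, hz']
  | tmul m x =>
    induction w using TensorProduct.induction_on with
    | zero => simp
    | add w w' hw hw' => rw [map_add, map_add, map_add, hw, hw']
    | tmul n y =>
      rw [TensorProduct.AlgebraTensorModule.map_tmul, TensorProduct.AlgebraTensorModule.map_tmul,
        RightHilbertModule.tensorForm_tmul, RightHilbertModule.tensorForm_tmul]
      exact congrArg (fun a => M.inner m (a • n)) (f.inner_apply x y)

/-- The inner-product preserving map `f ⊗ id : X ⊗_A M → Y ⊗_A M`. -/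
def tensorId (f : InnerMap X Y) (M : CStarCorrespondence A) :
    InnerMap (X.tensor M) (Y.tensor M) :=
  PreHilbertModule.completionMap
    (TensorProduct.AlgebraTensorModule.map (LinearMap.id : M →ₗ[Aᵐᵒᵖ] M)
      ((f : X →ₗ[Aᵐᵒᵖ] Y).restrictScalars ℂ)) (f.tensorForm_map M)

@[simp] lemma tensorId_tmul (f : InnerMap X Y) (M : CStarCorrespondence A) (x : X) (m : M) :
    f.tensorId M (RightHilbertModule.tmul x m) = RightHilbertModule.tmul (f x) m :=
  PreHilbertModule.completionMap_of _ _ _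

end InnerMap

namespace InnerEquiv

/-- The isomorphism `f ⊗ id : X ⊗_A M → Y ⊗_A M`. -/
def tensorId (f : InnerEquiv X Y) (M : CStarCorrespondence A) :
    InnerEquiv (X.tensor M) (Y.tensor M) where
  toLinearEquiv := LinearEquiv.ofLinearMap (f.toInnerMap.tensorId M).toLinearMap
    (f.symm.toInnerMap.tensorId M).toLinearMap
    (LinearMap.ext fun z => DFunLike.congr_fun (RightHilbertModule.tensor_ext
      (f := (f.toInnerMap.tensorId M).comp (f.symm.toInnerMap.tensorId M))
      (g := InnerMap.id _) fun x m => by simp) z)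
    (LinearMap.ext fun z => DFunLike.congr_fun (RightHilbertModule.tensor_ext
      (f := (f.symm.toInnerMap.tensorId M).comp (f.toInnerMap.tensorId M))
      (g := InnerMap.id _) fun x m => by simp) z)
  inner_map := (f.toInnerMap.tensorId M).inner_map

@[simp] lemma tensorId_tmul (f : InnerEquiv X Y) (M : CStarCorrespondence A) (x : X) (m : M) :
    f.tensorId M (RightHilbertModule.tmul x m) = RightHilbertModule.tmul (f x) m :=
  InnerMap.tensorId_tmul f.toInnerMap M x m

end InnerEquiv

end Tensor

section Powers

variable {A : Type u} [CStarAlgebra A] [PartialOrder A] [StarOrderedRing A]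

/-- The modules `X ⊗_A M^{⊗ k}`, bracketed to the left:
`X ⊗_A M^{⊗ 0} = X` and `X ⊗_A M^{⊗ (k + 1)} = (X ⊗_A M^{⊗ k}) ⊗_A M`. -/
def RightHilbertModule.tensorPow (X : RightHilbertModule A) (M : CStarCorrespondence A) :
    ℕ → RightHilbertModule A
  | 0 => X
  | k + 1 => (X.tensorPow M k).tensor M

/-- The elementary tensor `x ⊗ m₁ ⊗ ⋯ ⊗ mₖ`. -/
def RightHilbertModule.tprod {X : RightHilbertModule A} {M : CStarCorrespondence A} (x : X) :
    ∀ {k : ℕ}, (Fin k → M) → X.tensorPow M k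
  | 0, _ => x
  | _ + 1, m => RightHilbertModule.tmul (RightHilbertModule.tprod x fun i => m i.castSucc)
      (m (Fin.last _))

/-- The maps `T ⊗ idₖ : Y ⊗_A M^{⊗ k} → Y ⊗_A M^{⊗ (k + 1)}` associated to `T : Y → Y ⊗_A M`. -/
def InnerMap.tensorIdPow {Y : RightHilbertModule A} {M : CStarCorrespondence A}
    (T : InnerMap Y (Y.tensor M)) : ∀ k, InnerMap (Y.tensorPow M k) (Y.tensorPow M (k + 1))
  | 0 => T
  | k + 1 => (T.tensorIdPow k).tensorId M

/-- The powers `U^k : Y → Y ⊗_A M^{⊗ k}` of an isomorphism `U : Y → Y ⊗_A M`, with `U^0 = id` and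
`U^{k + 1} = (U^k ⊗ id) ∘ U`. -/
def InnerEquiv.dilationPow {Y : RightHilbertModule A} {M : CStarCorrespondence A}
    (U : InnerEquiv Y (Y.tensor M)) : ∀ k, InnerEquiv Y (Y.tensorPow M k)
  | 0 => InnerEquiv.refl Y
  | k + 1 => U.trans ((U.dilationPow k).tensorId M)

end Powers

section DirectLimit

variable {A : Type u} [CStarAlgebra A] [PartialOrder A]
  (X : ℕ → RightHilbertModule A) (T : ∀ k, InnerMap (X k) (X (k + 1)))

/-- The composite `T_{j-1} ∘ ⋯ ∘ T_i : X_i → X_j` in a direct system. -/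
def transition (i j : ℕ) (h : i ≤ j) : InnerMap (X i) (X j) :=
  Nat.leRecOn h (fun {k} f => (T k).comp f) (InnerMap.id (X i))

lemma transition_self (i : ℕ) (x : X i) : transition X T i i le_rfl x = x := by
  unfold transition
  rw [Nat.leRecOn_self]
  rfl

lemma transition_succ (i j : ℕ) (h : i ≤ j) (x : X i) :
    transition X T i (j + 1) (h.trans (Nat.le_succ j)) x = T j (transition X T i j h x) := by
  unfold transition
  rw [Nat.leRecOn_succ h]
  rfl

instance : DirectedSystem (fun k => X k) (fun _ _ h => transition X T _ _ h) where
  map_self i x := transition_self X T i x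
  map_map k j i hij hjk x := by
    induction k, hjk using Nat.le_induction with
    | base => exact transition_self X T _ _
    | succ n hn ih =>
      rw [transition_succ X T _ _ hn, transition_succ X T _ _ (hij.trans hn), ih]

/-- The algebraic direct limit of a sequence of Hilbert modules. -/
abbrev AlgLimit : Type u := DirectLimit (fun k => X k) (transition X T)

instance : Module ℂ (AlgLimit X T) := Module.compHom _ (algebraMap ℂ Aᵐᵒᵖ)

instance : IsScalarTower ℂ Aᵐᵒᵖ (AlgLimit X T) where
  smul_assoc c a x := by
    rw [Algebra.smul_def, mul_smul]
    rfl

/-- The inner product on the algebraic direct limit: `⟨[x], [y]⟩ = ⟨x, y⟩` for `x` and `y` in the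
same `X_k`. -/
def algLimitPre : PreHilbertModule A (AlgLimit X T) where
  inner := DirectLimit.lift₂ (transition X T) (transition X T) (fun k x y => (X k).inner x y)
    fun i j h x y => ((transition X T i j h).inner_apply x y).symm
  inner_add_right x y z := by
    induction x, y, z using DirectLimit.induction₃ with
    | ih i x y z =>
      rw [DirectLimit.add_def, DirectLimit.lift₂_def, DirectLimit.lift₂_def,
        DirectLimit.lift₂_def, (X i).inner_add_right]
  inner_smul_right x y a := by
    induction x, y using DirectLimit.induction₂ with
    | ih i x y =>
      rw [DirectLimit.smul_def, DirectLimit.lift₂_def, DirectLimit.lift₂_def,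
        (X i).inner_smul_right]
  star_inner x y := by
    induction x, y using DirectLimit.induction₂ with
    | ih i x y => rw [DirectLimit.lift₂_def, DirectLimit.lift₂_def, (X i).star_inner]
  inner_self_nonneg x := by
    induction x using DirectLimit.induction with
    | ih i x =>
      rw [DirectLimit.lift₂_def]
      exact (X i).inner_self_nonneg x

variable [StarOrderedRing A]

/-- The direct limit Hilbert module of a sequence of Hilbert modules and inner-product preserving
maps: the completion of the algebraic direct limit. -/
def limitModule : RightHilbertModule A := (algLimitPre X T).completion

/-- The canonical map of `X_k` into the direct limit. -/
def limitMap (k : ℕ) : InnerMap (X k) (limitModule X T) where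
  toFun x := (algLimitPre X T).of ⟦⟨k, x⟩⟧
  map_add' x y := by
    refine Eq.trans ?_ ((algLimitPre X T).of.map_add _ _)
    rw [DirectLimit.add_def]
  map_smul' a x := by
    refine Eq.trans ?_ ((algLimitPre X T).of.map_smul a _)
    rw [DirectLimit.smul_def]
  inner_map x y := by
    refine ((algLimitPre X T).inner_of _ _).trans ?_
    exact DirectLimit.lift₂_def (transition X T) (transition X T)
      (fun k x y => (X k).inner x y)
      (fun i j h x y => ((transition X T i j h).inner_apply x y).symm) k x y

lemma limitMap_comp (k : ℕ) (x : X k) : limitMap X T (k + 1) (T k x) = limitMap X T k x := by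
  have h := DirectLimit.mk_apply (f := transition X T) k (k + 1) x (Nat.le_succ k)
  rw [transition_succ X T k k le_rfl, transition_self] at h
  exact congrArg (algLimitPre X T).of h

end DirectLimit

section Correspondences

open UniformSpace

variable {A : Type u} [CStarAlgebra A] [PartialOrder A]

/-- An `A`-valued semi-inner product on a right `A`-module that also carries a left action of `A` by
adjointable operators. -/
structure PreCorrespondence (A E : Type u) [CStarAlgebra A] [PartialOrder A] [AddCommGroup E]
    [Module ℂ E] [Module Aᵐᵒᵖ E] [IsScalarTower ℂ Aᵐᵒᵖ E] [Module A E] [IsScalarTower ℂ A E]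
    extends PreHilbertModule A E where
  inner_left_smul : ∀ (a : A) x y, inner (a • x) y = inner x (star a • y)

namespace PreCorrespondence

variable {E : Type u} [AddCommGroup E] [Module ℂ E] [Module Aᵐᵒᵖ E] [IsScalarTower ℂ Aᵐᵒᵖ E]
  [Module A E] [IsScalarTower ℂ A E] [StarOrderedRing A] (P : PreCorrespondence A E)

instance : Module A P.toPreHilbertModule.Space := inferInstanceAs (Module A E)

instance : IsScalarTower ℂ A P.toPreHilbertModule.Space := inferInstanceAs (IsScalarTower ℂ A E)

lemma inner_left_smul_self_le (a : A) (x : E) :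
    P.inner (a • x) (a • x) ≤ ‖a‖ ^ 2 • P.inner x x := by
  obtain ⟨b, hb⟩ : ∃ b : A, algebraMap ℝ A (‖a‖ ^ 2) - star a * a = star b * b := by
    refine CStarAlgebra.nonneg_iff_eq_star_mul_self.1 (sub_nonneg.2 ?_)
    have h := IsSelfAdjoint.le_algebraMap_norm_self (IsSelfAdjoint.star_mul_self a)
    rwa [CStarRing.norm_star_mul_self, ← sq] at h
  have h0 : 0 ≤ P.inner (b • x) (b • x) := P.inner_self_nonneg _
  have hc : (algebraMap ℝ A (‖a‖ ^ 2)) • x = ((‖a‖ ^ 2 : ℝ) : ℂ) • x := by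
    rw [Algebra.algebraMap_eq_smul_one, ← Complex.coe_smul, smul_assoc, one_smul]
  rw [P.inner_left_smul, smul_smul, ← hb, sub_smul, P.toPreHilbertModule.inner_sub_right, hc,
    P.toPreHilbertModule.inner_csmul_right, Complex.coe_smul, sub_nonneg] at h0
  rwa [P.inner_left_smul, smul_smul]

lemma norm_left_smul_le (a : A) (x : P.toPreHilbertModule.Space) : ‖a • x‖ ≤ ‖a‖ * ‖x‖ := by
  have h : ‖a • x‖ ^ 2 ≤ (‖a‖ * ‖x‖) ^ 2 := by
    rw [P.toPreHilbertModule.norm_sq_eq, mul_pow, P.toPreHilbertModule.norm_sq_eq]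
    refine (CStarAlgebra.norm_le_norm_of_nonneg_of_le (P.inner_self_nonneg _)
      (P.inner_left_smul_self_le a x)).trans ?_
    rw [norm_smul, norm_pow, norm_norm]
    exact le_rfl
  exact le_of_sq_le_sq h (by positivity)

instance : UniformContinuousConstSMul A P.toPreHilbertModule.Space :=
  P.toPreHilbertModule.uniformContinuousConstSMul_of_bound fun a =>
    ⟨‖a‖, fun x => P.norm_left_smul_le a x⟩

lemma cip_left_smul (a : A) (x y : Completion P.toPreHilbertModule.Space) :
    P.toPreHilbertModule.cip (a • x) y = P.toPreHilbertModule.cip x (star a • y) := by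
  refine Completion.induction_on₂ x y (isClosed_eq ?_ ?_) fun x y => ?_
  · exact Continuous.cip _ ((continuous_const_smul a).comp continuous_fst) continuous_snd
  · exact Continuous.cip _ continuous_fst ((continuous_const_smul (star a)).comp continuous_snd)
  · rw [← Completion.coe_smul, ← Completion.coe_smul, PreHilbertModule.cip_coe,
      PreHilbertModule.cip_coe]
    exact P.inner_left_smul a x y

/-- The completion of a pre-correspondence. -/
def completion : CStarCorrespondence A where
  toRightHilbertModule := P.toPreHilbertModule.completion
  leftModule := inferInstanceAs (Module A (Completion P.toPreHilbertModule.Space))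
  leftIsScalarTower := inferInstanceAs (IsScalarTower ℂ A (Completion P.toPreHilbertModule.Space))
  inner_left_smul := P.cip_left_smul

end PreCorrespondence

/-- A transfer operator for the (unital) endomorphism `α` of `A`: a positive linear map `L` such
that `L (a α(b)) = L(a) b`. -/
structure TransferOperator (α : A →⋆ₐ[ℂ] A) where
  toLinearMap : A →ₗ[ℂ] A
  nonneg : ∀ a, 0 ≤ a → 0 ≤ toLinearMap a
  map_mul : ∀ a b, toLinearMap (a * α b) = toLinearMap a * b

/-- The vector space `A_L = A`, with the right action `m · a = m α(a)` and the left action by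
multiplication. -/
def TransferSpace (_ : A →⋆ₐ[ℂ] A) : Type u := A

namespace TransferSpace

variable (α : A →⋆ₐ[ℂ] A)

instance : AddCommGroup (TransferSpace α) := inferInstanceAs (AddCommGroup A)
instance : Module ℂ (TransferSpace α) := inferInstanceAs (Module ℂ A)
instance : Module A (TransferSpace α) := inferInstanceAs (Module A A)
instance : IsScalarTower ℂ A (TransferSpace α) := inferInstanceAs (IsScalarTower ℂ A A)

instance : Module Aᵐᵒᵖ (TransferSpace α) where
  smul a m := (show A from m) * α a.unop
  one_smul m := by
    change (show A from m) * α 1 = m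
    rw [map_one, mul_one]
  mul_smul a b m := by
    change (show A from m) * α (b.unop * a.unop) = (show A from m) * α b.unop * α a.unop
    rw [_root_.map_mul, mul_assoc]
  smul_zero a := zero_mul (α a.unop)
  smul_add a m n := add_mul (show A from m) (show A from n) (α a.unop)
  add_smul a b m := by
    change (show A from m) * α (a.unop + b.unop) = _
    rw [map_add, mul_add]
    rfl
  zero_smul m := by
    change (show A from m) * α 0 = 0
    rw [map_zero, mul_zero]

lemma op_smul_def (m : TransferSpace α) (a : A) : m <• a = ((show A from m) * α a : A) := rfl

instance : IsScalarTower ℂ Aᵐᵒᵖ (TransferSpace α) where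
  smul_assoc c a m := by
    change (show A from m) * α (c • a.unop) = c • ((show A from m) * α a.unop)
    rw [map_smul, mul_smul_comm]

end TransferSpace

namespace TransferOperator

variable {α : A →⋆ₐ[ℂ] A} [StarOrderedRing A] (L : TransferOperator α)

lemma map_star (a : A) : L.toLinearMap (star a) = star (L.toLinearMap a) := by
  obtain ⟨y, hy, -, ha⟩ := CStarAlgebra.exists_sum_four_nonneg a
  have hs : ∀ i, star (y i) = y i := fun i => (hy i).isSelfAdjoint
  have hL : ∀ i, star (L.toLinearMap (y i)) = L.toLinearMap (y i) :=
    fun i => (L.nonneg _ (hy i)).isSelfAdjoint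
  rw [ha]
  simp only [star_sum, star_smul, map_sum, map_smul, hs, hL]

/-- The pre-correspondence structure `⟨m, n⟩ = L(m* n)` on `A_L`. -/
def pre : PreCorrespondence A (TransferSpace α) where
  inner m n := L.toLinearMap (star (show A from m) * (show A from n))
  inner_add_right m n n' := by
    change L.toLinearMap (star (show A from m) * ((show A from n) + (show A from n'))) = _
    rw [mul_add, map_add]
  inner_smul_right m n a := by
    change L.toLinearMap (star (show A from m) * ((show A from n) * α a)) = _
    rw [← mul_assoc, L.map_mul]
  star_inner m n := by
    rw [← L.map_star, star_mul, star_star]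
  inner_self_nonneg m := L.nonneg _ (star_mul_self_nonneg _)
  inner_left_smul a m n := by
    change L.toLinearMap (star (a * (show A from m)) * (show A from n)) =
      L.toLinearMap (star (show A from m) * (star a * (show A from n)))
    rw [star_mul, mul_assoc]

/-- Exel's correspondence `M_L`: the completion of `A_L`. -/
def correspondence : CStarCorrespondence A := L.pre.completion

/-- The canonical map `A = A_L → M_L`. -/
def toM (a : A) : L.correspondence := L.pre.toPreHilbertModule.of (show TransferSpace α from a)

lemma inner_toM (a b : A) :
    L.correspondence.inner (L.toM a) (L.toM b) = L.toLinearMap (star a * b) :=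
  L.pre.toPreHilbertModule.inner_of _ _

end TransferOperator

end Correspondences

section LocalHomeomorphism

variable {C : Type u} [TopologicalSpace C] [CompactSpace C] [T2Space C]

/-- The endomorphism `f ↦ f ∘ σ` of `C(C)`. -/
def pullbackHom (σ : C(C, C)) : C(C, ℂ) →⋆ₐ[ℂ] C(C, ℂ) := ContinuousMap.compStarAlgHom' ℂ ℂ σ

/-- The average `|σ⁻¹(c)|⁻¹ ∑_{σ(d) = c} f(d)` of `f` over the fibre of `σ` at `c`. -/
def fibreAverage (σ : C(C, C)) (f : C → ℂ) (c : C) : ℂ :=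
  (Nat.card (σ ⁻¹' {c}) : ℂ)⁻¹ * ∑ᶠ d : σ ⁻¹' {c}, f d

lemma finite_fibre {σ : C(C, C)} (hσ : IsLocalHomeomorph σ) (c : C) : Finite (σ ⁻¹' {c}) := by
  have hd : DiscreteTopology (σ ⁻¹' {c}) :=
    (isLocalHomeomorph_iff_isCoveringMap.1 hσ c).discreteTopology_fiber
  have hc : CompactSpace (σ ⁻¹' {c}) :=
    isCompact_iff_compactSpace.1 ((isClosed_singleton.preimage σ.continuous).isCompact)
  exact finite_of_compact_of_discrete

lemma continuous_fibreAverage {σ : C(C, C)} (hσ : IsLocalHomeomorph σ) (f : C(C, ℂ)) :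
    Continuous (fibreAverage σ f) := by
  rw [continuous_iff_continuousAt]
  intro c₀
  have hfin := finite_fibre hσ c₀
  obtain ⟨_, U, hcU, hU, _, H, hH⟩ := isLocalHomeomorph_iff_isCoveringMap.1 hσ c₀
  have hfI : Fintype (σ ⁻¹' {c₀}) := Fintype.ofFinite _
  let s : U → (σ ⁻¹' {c₀}) → C := fun c i => (H.symm (c, i)).1
  have hs : ∀ c i, σ (s c i) = c.1 := fun c i => by
    have := hH (H.symm (c, i))
    rw [H.apply_symm_apply] at this
    exact this.symm
  have hbij : ∀ c : U, Function.Bijective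
      (fun i => (⟨s c i, hs c i⟩ : σ ⁻¹' {c.1})) := by
    intro c
    constructor
    · intro i j hij
      have h0 : s c i = s c j := (Subtype.mk.injEq _ _ _ _).mp hij
      have h1 : H.symm (c, i) = H.symm (c, j) := Subtype.ext h0
      exact congrArg Prod.snd (H.symm.injective h1)
    · rintro ⟨d, hd⟩
      have hdU : d ∈ σ ⁻¹' U := by
        have : σ d = c.1 := hd
        simp [this]
      refine ⟨(H ⟨d, hdU⟩).2, Subtype.ext ?_⟩
      have h1 : (H ⟨d, hdU⟩).1 = c := Subtype.ext ((hH ⟨d, hdU⟩).trans hd)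
      have h2 : (c, (H ⟨d, hdU⟩).2) = H ⟨d, hdU⟩ := Prod.ext h1.symm rfl
      change (H.symm (c, (H ⟨d, hdU⟩).2)).1 = d
      rw [h2, H.symm_apply_apply]
  have heq : ∀ c : U, fibreAverage σ f c =
      (Nat.card (σ ⁻¹' {c₀}) : ℂ)⁻¹ * ∑ i, f (s c i) := by
    intro c
    unfold fibreAverage
    rw [← Nat.card_eq_of_bijective _ (hbij c),
      ← finsum_eq_of_bijective (f := fun i => f (s c i)) _ (hbij c) (fun _ => rfl),
      finsum_eq_sum_of_fintype]
  have hcont : Continuous fun c : U => fibreAverage σ f c := by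
    simp only [heq]
    have hsc : ∀ i, Continuous fun c : U => s c i := fun i =>
      continuous_subtype_val.comp (H.symm.continuous.comp (by fun_prop))
    exact continuous_const.mul (continuous_finsetSum _ fun i _ => f.continuous.comp (hsc i))
  exact (continuousOn_iff_continuous_domRestrict.2 hcont).continuousAt (hU.mem_nhds hcU)

/-- The transfer operator `L(f)(c) = |σ⁻¹(c)|⁻¹ ∑_{σ(d) = c} f(d)` for `f ↦ f ∘ σ`, where `σ` is a
local homeomorphism of a compact space. -/
def averagingTransfer (σ : C(C, C)) (hσ : IsLocalHomeomorph σ) :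
    TransferOperator (pullbackHom σ) where
  toLinearMap :=
    { toFun := fun f => ⟨fibreAverage σ f, continuous_fibreAverage hσ f⟩
      map_add' := fun f g => by
        ext c
        have := finite_fibre hσ c
        change fibreAverage σ (fun d => f d + g d) c = fibreAverage σ f c + fibreAverage σ g c
        unfold fibreAverage
        rw [finsum_add_distrib (Set.toFinite _) (Set.toFinite _), mul_add]
      map_smul' := fun a f => by
        ext c
        have hfin := finite_fibre hσ c
        have hfI : Fintype (σ ⁻¹' {c}) := Fintype.ofFinite _
        change fibreAverage σ (fun d => a * f d) c = a * fibreAverage σ f c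
        simp only [fibreAverage, finsum_eq_sum_of_fintype]
        rw [← Finset.mul_sum, mul_left_comm] }
  nonneg f hf := by
    rw [ContinuousMap.le_def] at hf ⊢
    intro c
    change 0 ≤ fibreAverage σ f c
    unfold fibreAverage
    refine mul_nonneg ?_ (finsum_nonneg fun d => hf d)
    rw [← Complex.ofReal_natCast, ← Complex.ofReal_inv, Complex.zero_le_real]
    positivity
  map_mul f g := by
    ext c
    have hfin := finite_fibre hσ c
    have hfI : Fintype (σ ⁻¹' {c}) := Fintype.ofFinite _
    change fibreAverage σ (fun d => f d * g (σ d)) c = fibreAverage σ f c * g c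
    simp only [fibreAverage, finsum_eq_sum_of_fintype]
    rw [mul_assoc, Finset.sum_mul]
    congr 1
    refine Finset.sum_congr rfl fun d _ => ?_
    have hd : σ d.1 = c := d.2
    rw [hd]

end LocalHomeomorphism

section Frames

variable {A : Type u} [CStarAlgebra A] [PartialOrder A]

/-- `(x i)` is a Parseval frame for the submodule `V` of `X`: the `x i` belong to `V` and
`⟨y, y⟩ = ∑ᵢ ⟨y, x i⟩ ⟨x i, y⟩`, with convergence in norm, for every `y ∈ V`. -/
def IsParsevalFrame {X : RightHilbertModule A} {ι : Type*} (V : Submodule Aᵐᵒᵖ X) (x : ι → X) :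
    Prop :=
  (∀ i, x i ∈ V) ∧
    ∀ y ∈ V, HasSum (fun i => X.inner y (x i) * X.inner (x i) y) (X.inner y y)

/-- The family `(x i)` is orthonormal: `⟨x i, x j⟩ = δ_{ij} 1`. -/
def IsOrthonormalFamily {X : RightHilbertModule A} {ι : Type*} (x : ι → X) : Prop :=
  (∀ i, X.inner (x i) (x i) = 1) ∧ ∀ i j, i ≠ j → X.inner (x i) (x j) = 0

/-- `(x i)` is an orthonormal basis for the submodule `V` of `X`: it is an orthonormal family in `V`
and `V` is contained in the closed submodule generated by the `x i`. -/
def IsOrthonormalModuleBasis {X : RightHilbertModule A} {ι : Type*} (V : Submodule Aᵐᵒᵖ X)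
    (x : ι → X) : Prop :=
  IsOrthonormalFamily x ∧ (∀ i, x i ∈ V) ∧
    (V : Set X) ⊆ closure (Submodule.span Aᵐᵒᵖ (Set.range x) : Set X)

/-- The range of an inner-product preserving map, as a submodule. -/
def InnerMap.range {X Y : RightHilbertModule A} (Q : InnerMap X Y) : Submodule Aᵐᵒᵖ Y :=
  LinearMap.range Q.toLinearMap

variable [StarOrderedRing A]

/-- The identity of `A`, as an element of the Hilbert module `A_A`. -/
def RightHilbertModule.selfOne (A : Type u) [CStarAlgebra A] [PartialOrder A]
    [StarOrderedRing A] : RightHilbertModule.self A := (1 : A)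

open RightHilbertModule

/-- The isometry `S_m : A_A → M ≅ A_A ⊗_A M`, `a ↦ m · a ≅ 1 ⊗ (m · a)`, associated to a filter `m`,
that is, an element of `M` such that `⟨m, m⟩ = 1`. -/
def filterMap (M : CStarCorrespondence A) (m : M) (hm : M.inner m m = 1) :
    InnerMap (RightHilbertModule.self A) ((RightHilbertModule.self A).tensor M) where
  toFun a := tmul (selfOne A) (m <• (show A from a))
  map_add' a b := by
    change tmul (selfOne A) (m <• ((show A from a) + (show A from b))) = _
    rw [MulOpposite.op_add, add_smul]
    exact (congrArg _ (TensorProduct.add_tmul _ _ _)).trans (map_add _ _ _)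
  map_smul' b a := by
    change tmul (selfOne A) (m <• ((show A from a) * b.unop)) = b • tmul (selfOne A) _
    rw [MulOpposite.op_mul, mul_smul]
    exact tmul_smul _ _ b.unop
  inner_map a b := by
    rw [inner_tmul]
    change M.inner ((star (1 : A) * 1) • _) _ = star (show A from a) * (show A from b)
    rw [star_one, one_mul, one_smul, M.inner_smul_right]
    have h : M.inner (m <• (show A from a)) m = star (show A from a) * M.inner m m :=
      M.pre.inner_smul_left _ _ _
    rw [h, hm, mul_one]

/-- The direct limit `M_∞` of the modules `M^{⊗ k} ≅ A_A ⊗_A M^{⊗ k}` with respect to the maps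
`S_m ⊗ idₖ : n ↦ m ⊗ n`. -/
def filterLimit (M : CStarCorrespondence A) (m : M) (hm : M.inner m m = 1) :
    RightHilbertModule A :=
  limitModule (fun k => (RightHilbertModule.self A).tensorPow M k)
    (fun k => (filterMap M m hm).tensorIdPow k)

/-- The canonical map `ι^k : M^{⊗ k} → M_∞`. -/
def filterLimitMap (M : CStarCorrespondence A) (m : M) (hm : M.inner m m = 1) (k : ℕ) :
    InnerMap ((RightHilbertModule.self A).tensorPow M k) (filterLimit M m hm) :=
  limitMap (fun k => (RightHilbertModule.self A).tensorPow M k)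
    (fun k => (filterMap M m hm).tensorIdPow k) k

/-- `(X, D, φ)` is a scaling function for `m`. -/
def IsScalingFunction {M : CStarCorrespondence A} (m : M) {X : RightHilbertModule A}
    (D : InnerEquiv X (X.tensor M)) (φ : X) : Prop :=
  X.inner φ φ = 1 ∧ D φ = tmul φ m

/-- `R` is the isomorphism `M_∞ ≅ M_∞ ⊗_A M` such that `R ∘ ι^{k+1} = ι^k ⊗ id`, and `Q` is the
inner-product preserving map `M_∞ → X` such that `Q (ι^0 1) = φ` and `D ∘ Q = (Q ⊗ id) ∘ R`. -/
structure IsRealization {M : CStarCorrespondence A} {m : M} {hm : M.inner m m = 1}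
    {X : RightHilbertModule A} (D : InnerEquiv X (X.tensor M)) (φ : X)
    (R : InnerEquiv (filterLimit M m hm) ((filterLimit M m hm).tensor M))
    (Q : InnerMap (filterLimit M m hm) X) : Prop where
  shift : ∀ k z, R (filterLimitMap M m hm (k + 1) z) = (filterLimitMap M m hm k).tensorId M z
  base : Q (filterLimitMap M m hm 0 (selfOne A)) = φ
  intertwine : ∀ z, D (Q z) = Q.tensorId M (R z)

/-- The index set of the frame: `none`, and the tuples `(j₁, …, j_{k+1})`, `k ≥ 0`, with
`j₁ ≠ j₀`. -/
abbrev FrameIndex {J : Type*} (j₀ : J) : Type _ :=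
  Option (Σ k : ℕ, {j : Fin (k + 1) → J // j 0 ≠ j₀})

/-- The family consisting of `φ` and of the vectors `D^{-k} (φ ⊗ m_{j₁} ⊗ ⋯ ⊗ m_{jₖ})`, where
`k ≥ 1` and `j₁ ≠ j₀`. -/
def frameVector {M : CStarCorrespondence A} {X : RightHilbertModule A}
    (D : InnerEquiv X (X.tensor M)) (φ : X) {J : Type*} (j₀ : J) (m : J → M) :
    FrameIndex j₀ → X
  | none => φ
  | some ⟨k, j⟩ => (D.dilationPow (k + 1)).symm (tprod φ fun l => m (j.1 l))

/-- `D` is an isomorphism of `X` onto `X_L`, the vector space `X` with the right action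
`x ·_L a = x · α(a)` and the inner product `⟨x, y⟩_L = L(⟨x, y⟩)`. -/
structure IsTransferDilation {α : A →⋆ₐ[ℂ] A} (L : TransferOperator α)
    {X : RightHilbertModule A} (D : X ≃ₗ[ℂ] X) : Prop where
  map_smul : ∀ (x : X) (a : A), D (x <• a) = D x <• α a
  inner_map : ∀ x y, L.toLinearMap (X.inner (D x) (D y)) = X.inner x y

/-- `R : M_∞ → (M_∞)_L` is the isomorphism `M_∞ ≅ M_∞ ⊗_A M_L` such that `R ∘ ι^{k+1} = ι^k ⊗ id`,
followed by the identification `x ⊗ a ↦ x · a` of `M_∞ ⊗_A M_L` with `(M_∞)_L`, and `Q` is the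
inner-product preserving map `M_∞ → X` such that `Q (ι^0 1) = φ` and `D ∘ Q = Q ∘ R`. -/
structure IsTransferRealization {α : A →⋆ₐ[ℂ] A} {L : TransferOperator α}
    {m : L.correspondence} {hm : L.correspondence.inner m m = 1}
    {X : RightHilbertModule A} (D : X ≃ₗ[ℂ] X) (φ : X)
    (R : filterLimit L.correspondence m hm ≃ₗ[ℂ] filterLimit L.correspondence m hm)
    (Q : InnerMap (filterLimit L.correspondence m hm) X) : Prop where
  dilation : IsTransferDilation L R
  shift : ∀ (k : ℕ) (z : (RightHilbertModule.self A).tensorPow L.correspondence k) (a : A),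
    R (filterLimitMap L.correspondence m hm (k + 1) (tmul z (L.toM a))) =
      filterLimitMap L.correspondence m hm k z <• a
  base : Q (filterLimitMap L.correspondence m hm 0 (selfOne A)) = φ
  intertwine : ∀ z, D (Q z) = Q (R z)

/-- The family consisting of `φ` and of the vectors
`D^{-k} (φ · (m_{j₁} α(m_{j₂}) ⋯ α^{k-1}(m_{jₖ})))`, where `k ≥ 1` and `j₁ ≠ j₀`, for a commutative
algebra such as `C(C)`. -/
def transferFrameVector {C : Type u} [TopologicalSpace C] [CompactSpace C]
    (α : C(C, ℂ) →⋆ₐ[ℂ] C(C, ℂ)) {X : RightHilbertModule C(C, ℂ)} (D : X ≃ₗ[ℂ] X) (φ : X)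
    {J : Type*} (j₀ : J) (m : J → C(C, ℂ)) : FrameIndex j₀ → X
  | none => φ
  | some ⟨k, j⟩ => D.symm^[k + 1] (φ <• ∏ l : Fin (k + 1), α^[(l : ℕ)] (m (j.1 l)))

end Frames

end

/-!
The maps `M_∞ → X` and `M_∞ → M_∞ ⊗ M` are produced by the universal property of the direct limit,
and they are unique because the ranges of the `ι^k` are dense. The frame vectors are determined by
`e_∅ = φ` and `D e_(j₁, …, jₖ, j) = e_(j₁, …, jₖ) ⊗ m_j`, where all the tuples `(j₀, …, j₀)` are
identified with `∅`.

A vector of norm one in a Parseval frame is orthogonal to the other members of the frame. Hence `φ`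
is orthogonal to all other `e_i`, and the Parseval identity holds on `φ · A = Q(ι^0(A))`. Tensoring
with the Parseval frame `(m_j)` preserves the identity, and `D` turns the family `(e_i)` into the
tensor products `e_i ⊗ m_j`, so the identity passes from `Q(ι^k(M^{⊗k}))` to the next stage
`Q(ι^(k+1)(M^{⊗(k+1)}))`. It extends to the closure because, by Bessel's inequality, the finite
defects `⟨y, y⟩ - ∑ ⟨y, e_i⟩⟨e_i, y⟩` are positive forms bounded by `⟨y, y⟩`.

A transfer operator `L` which is bounded below on positive elements makes `x ↦ x ⊗ 1` an isomorphism
of `X_L`, the space `X` with inner product `L(⟨x, y⟩)`, onto `X ⊗ M_L`, which turns dilations of `X`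
into isomorphisms `X → X ⊗ M_L`. Averages over fibres are bounded below since the cardinalities of
the fibres of a local homeomorphism of a compact space are bounded.
-/

noncomputable section

open RightHilbertModule

section Topology

variable {A : Type u} [CStarAlgebra A] [PartialOrder A] {X Y : RightHilbertModule A}

lemma InnerMap.norm_map (f : InnerMap X Y) (x : X) : ‖f x‖ = ‖x‖ := by
  rw [Y.norm_eq, X.norm_eq, f.inner_apply]

lemma InnerMap.isometry (f : InnerMap X Y) : Isometry f :=
  AddMonoidHomClass.isometry_of_norm f f.norm_map

@[fun_prop]
lemma InnerMap.continuous (f : InnerMap X Y) : Continuous f := f.isometry.continuous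

@[fun_prop]
lemma InnerEquiv.continuous (f : InnerEquiv X Y) : Continuous f := f.toInnerMap.continuous

lemma InnerMap.isClosed_range (f : InnerMap X Y) : IsClosed (Set.range f) :=
  f.isometry.isClosedEmbedding.isClosed_range

/-- A surjective inner-product preserving map, regarded as an isomorphism. -/
def InnerMap.equivOfSurjective (f : InnerMap X Y) (hf : Function.Surjective f) :
    InnerEquiv X Y where
  toLinearEquiv := LinearEquiv.ofBijective f.toLinearMap ⟨f.isometry.injective, hf⟩
  inner_map := f.inner_map

@[simp] lemma InnerMap.equivOfSurjective_apply (f : InnerMap X Y) (hf : Function.Surjective f)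
    (x : X) : f.equivOfSurjective hf x = f x := rfl

lemma InnerEquiv.toInnerMap_comp_injective {Z : RightHilbertModule A} (D : InnerEquiv Y Z) :
    Function.Injective (D.toInnerMap.comp : InnerMap X Y → InnerMap X Z) := fun _ _ h =>
  InnerMap.ext fun x => EquivLike.injective D (DFunLike.congr_fun h x)

lemma RightHilbertModule.ext_inner_left {x y : X} (h : ∀ z, X.inner z x = X.inner z y) : x = y := by
  have h0 : X.inner (x - y) (x - y) = 0 := by
    rw [show X.inner = X.pre.inner from rfl, X.pre.inner_sub_right]
    exact sub_eq_zero.2 (h _)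
  rw [← sub_eq_zero, ← norm_eq_zero, X.norm_eq, h0, norm_zero, Real.sqrt_zero]

lemma InnerMap.self_ext [StarOrderedRing A] {f g : InnerMap (RightHilbertModule.self A) X}
    (h : f (selfOne A) = g (selfOne A)) : f = g := by
  ext a
  have ha : a = selfOne A <• (show A from a) := (one_mul (show A from a)).symm
  rw [ha, map_smul, map_smul, h]

variable [StarOrderedRing A]

lemma RightHilbertModule.norm_inner_le (x y : X) : ‖X.inner x y‖ ≤ ‖x‖ * ‖y‖ := by
  rw [X.norm_eq, X.norm_eq]
  exact X.pre.norm_inner_le x y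

@[fun_prop]
lemma RightHilbertModule.continuous_inner {T : Type*} [TopologicalSpace T] {f g : T → X}
    (hf : Continuous f) (hg : Continuous g) : Continuous fun t => X.inner (f t) (g t) := by
  let i : X →+ X.pre.Space := AddMonoidHom.id X
  have hi : Isometry i := AddMonoidHomClass.isometry_of_norm i fun x => (X.norm_eq x).symm
  exact X.pre.continuous_ip.comp ((hi.continuous.comp hf).prodMk (hi.continuous.comp hg))

end Topology

section CompletionLift

variable {A E : Type u} [CStarAlgebra A] [PartialOrder A] [StarOrderedRing A]
  [AddCommGroup E] [Module ℂ E] [Module Aᵐᵒᵖ E] [IsScalarTower ℂ Aᵐᵒᵖ E]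
  {P : PreHilbertModule A E} {Y : RightHilbertModule A}

lemma PreHilbertModule.completion_induction {p : P.completion → Prop}
    (hc : IsClosed {z | p z}) (h : ∀ x, p (P.of x)) (z : P.completion) : p z :=
  UniformSpace.Completion.induction_on (α := P.Space) z hc h

variable (P) in
lemma PreHilbertModule.denseRange_of : DenseRange P.of :=
  UniformSpace.Completion.denseRange_coe (α := P.Space)

variable (Y) in
/-- The canonical map from a Hilbert module to its completion. -/
def RightHilbertModule.toCompletion : InnerMap Y Y.pre.completion where
  toLinearMap := Y.pre.of
  inner_map := Y.pre.inner_of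

variable (Y) in
/-- A Hilbert module is its own completion. -/
def RightHilbertModule.completionEquiv : InnerEquiv Y Y.pre.completion :=
  Y.toCompletion.equivOfSurjective <| PreHilbertModule.completion_induction
    (p := (· ∈ Set.range Y.toCompletion)) Y.toCompletion.isClosed_range Set.mem_range_self

/-- The extension to the completion of an inner-product preserving module map into a Hilbert
module. -/
def PreHilbertModule.completionLift (f : E →ₗ[Aᵐᵒᵖ] Y)
    (hf : ∀ x y, Y.inner (f x) (f y) = P.inner x y) : InnerMap P.completion Y :=
  Y.completionEquiv.symm.toInnerMap.comp (completionMap f hf)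

lemma PreHilbertModule.completionLift_of (f : E →ₗ[Aᵐᵒᵖ] Y)
    (hf : ∀ x y, Y.inner (f x) (f y) = P.inner x y) (x : E) :
    completionLift f hf (P.of x) = f x :=
  (congrArg _ (completionMap_of f hf x)).trans (Y.completionEquiv.symm_apply_apply (f x))

end CompletionLift

section Tensor

variable {A : Type u} [CStarAlgebra A] [PartialOrder A] [StarOrderedRing A]
  {X Y Z : RightHilbertModule A} {M : CStarCorrespondence A}

lemma CStarCorrespondence.norm_left_smul_le (a : A) (m : M) : ‖a • m‖ ≤ ‖a‖ * ‖m‖ := by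
  let P : PreCorrespondence A M := { M.pre with inner_left_smul := M.inner_left_smul }
  rw [M.norm_eq, M.norm_eq]
  exact P.norm_left_smul_le a m

lemma CStarCorrespondence.continuous_smul_left (m : M) : Continuous fun a : A => a • m :=
  (AddMonoidHomClass.lipschitz_of_bound
    (AddMonoidHom.mk' (fun a : A => a • m) fun a b => add_smul a b m) ‖m‖ fun a =>
      (M.norm_left_smul_le a m).trans_eq (mul_comm _ _)).continuous

namespace RightHilbertModule

lemma tensor_induction {p : X.tensor M → Prop} (hc : IsClosed {z | p z})
    (hadd : ∀ z w, p z → p w → p (z + w)) (h : ∀ x m, p (tmul x m)) (z : X.tensor M) : p z := by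
  refine PreHilbertModule.completion_induction hc (fun z => ?_) z
  induction z using TensorProduct.induction_on with
  | zero => simpa only [tmul, TensorProduct.zero_tmul] using h 0 0
  | add z w hz hw => rw [map_add]; exact hadd _ _ hz hw
  | tmul m x => exact h x m

lemma inner_tmul_right (x y : X) (m n : M) :
    (X.tensor M).inner (tmul x m) (tmul y n) = M.inner m (X.inner x y • n) :=
  (X.tensorPre M).inner_of _ _

lemma tmul_add (x : X) (m n : M) : (tmul x (m + n) : X.tensor M) = tmul x m + tmul x n :=
  (congrArg _ (TensorProduct.add_tmul _ _ _)).trans (map_add _ _ _)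

lemma add_tmul (x y : X) (m : M) : (tmul (x + y) m : X.tensor M) = tmul x m + tmul y m :=
  (congrArg _ (TensorProduct.tmul_add _ _ _)).trans (map_add _ _ _)

lemma norm_tmul_le (x : X) (m : M) : ‖(tmul x m : X.tensor M)‖ ≤ ‖x‖ * ‖m‖ := by
  have hx : ‖X.inner x x‖ = ‖x‖ ^ 2 := by rw [X.norm_eq x, Real.sq_sqrt (norm_nonneg _)]
  rw [(X.tensor M).norm_eq, inner_tmul_right]
  refine Real.sqrt_le_iff.2 ⟨by positivity, ?_⟩
  calc ‖M.inner m (X.inner x x • m)‖ ≤ ‖m‖ * ‖X.inner x x • m‖ := M.norm_inner_le _ _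
    _ ≤ ‖m‖ * (‖X.inner x x‖ * ‖m‖) := by gcongr; exact M.norm_left_smul_le _ _
    _ = (‖x‖ * ‖m‖) ^ 2 := by rw [hx]; ring

lemma continuous_tmul_left (m : M) : Continuous fun x : X => (tmul x m : X.tensor M) :=
  (AddMonoidHomClass.lipschitz_of_bound
    (AddMonoidHom.mk' (fun x : X => (tmul x m : X.tensor M)) fun x y => add_tmul x y m) ‖m‖
      fun x => (norm_tmul_le x m).trans_eq (mul_comm _ _)).continuous

lemma continuous_tmul_right (x : X) : Continuous fun m : M => (tmul x m : X.tensor M) :=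
  (AddMonoidHomClass.lipschitz_of_bound
    (AddMonoidHom.mk' (fun m : M => (tmul x m : X.tensor M)) fun m n => tmul_add x m n) ‖x‖
      fun m => norm_tmul_le x m).continuous

end RightHilbertModule

lemma InnerMap.tensorId_comp (g : InnerMap Y Z) (f : InnerMap X Y) (M : CStarCorrespondence A) :
    (g.comp f).tensorId M = (g.tensorId M).comp (f.tensorId M) :=
  tensor_ext fun x m => by simp only [comp_apply, tensorId_tmul]

end Tensor

section LimitLift

variable {A : Type u} [CStarAlgebra A] [PartialOrder A] {X : ℕ → RightHilbertModule A}
  {T : ∀ k, InnerMap (X k) (X (k + 1))} {Y : RightHilbertModule A}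

lemma apply_transition {g : ∀ k, InnerMap (X k) Y} (hg : ∀ k, (g (k + 1)).comp (T k) = g k)
    (i j : ℕ) (h : i ≤ j) (x : X i) : g i x = g j (transition X T i j h x) := by
  induction j, h using Nat.le_induction with
  | base => rw [transition_self]
  | succ n hn ih => rw [transition_succ X T _ _ hn, ← InnerMap.comp_apply, hg, ← ih]

variable [StarOrderedRing A]

lemma limit_induction {p : limitModule X T → Prop} (hc : IsClosed {z | p z})
    (h : ∀ k x, p (limitMap X T k x)) (z : limitModule X T) : p z := by
  refine PreHilbertModule.completion_induction hc (fun z => ?_) z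
  induction z using DirectLimit.induction with
  | ih k x => exact h k x

/-- The map out of the Hilbert-module direct limit given by a compatible family of maps: the
universal property of the limit. -/
def limitLift (g : ∀ k, InnerMap (X k) Y) (hg : ∀ k, (g (k + 1)).comp (T k) = g k) :
    InnerMap (limitModule X T) Y :=
  PreHilbertModule.completionLift (P := algLimitPre X T)
    { toFun := DirectLimit.lift (transition X T) (fun k x => g k x) (apply_transition hg)
      map_add' := fun x y => by
        induction x, y using DirectLimit.induction₂ with
        | ih i x y => rw [DirectLimit.add_def]; exact map_add (g i) x y
      map_smul' := fun a x => by
        induction x using DirectLimit.induction with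
        | ih i x => rw [DirectLimit.smul_def]; exact map_smul (g i) a x }
    (fun x y => by
      induction x, y using DirectLimit.induction₂ with
      | ih i x y =>
        exact ((g i).inner_apply x y).trans (DirectLimit.lift₂_def (transition X T)
          (transition X T) (fun k x y => (X k).inner x y)
          (fun i j h x y => ((transition X T i j h).inner_apply x y).symm) i x y).symm)

lemma limitLift_comp_limitMap (g : ∀ k, InnerMap (X k) Y)
    (hg : ∀ k, (g (k + 1)).comp (T k) = g k) (k : ℕ) :
    (limitLift g hg).comp (limitMap X T k) = g k :=
  InnerMap.ext fun _ => PreHilbertModule.completionLift_of _ _ _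

end LimitLift

section Realization

variable {A : Type u} [CStarAlgebra A] [PartialOrder A] [StarOrderedRing A]
  {M : CStarCorrespondence A} {m : M} {hm : M.inner m m = 1} {X : RightHilbertModule A}

lemma filterLimitMap_comp_tensorIdPow (k : ℕ) :
    (filterLimitMap M m hm (k + 1)).comp ((filterMap M m hm).tensorIdPow k) =
      filterLimitMap M m hm k :=
  InnerMap.ext (limitMap_comp _ _ k)

lemma filterLimit_induction {p : filterLimit M m hm → Prop} (hc : IsClosed {z | p z})
    (h : ∀ k x, p (filterLimitMap M m hm k x)) (z : filterLimit M m hm) : p z :=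
  limit_induction hc h z

lemma filterLimit_ext {f g : InnerMap (filterLimit M m hm) X}
    (h : ∀ k, f.comp (filterLimitMap M m hm (k + 1)) = g.comp (filterLimitMap M m hm (k + 1))) :
    f = g := by
  refine InnerMap.ext (filterLimit_induction (isClosed_eq f.continuous g.continuous) fun k x => ?_)
  rw [← filterLimitMap_comp_tensorIdPow]
  exact DFunLike.congr_fun (h k) _

variable (M m hm) in
/-- The compatible maps `M^{⊗ k} → M_∞ ⊗_A M` which induce the isomorphism `R` on the limit: they
are `ι^{k-1} ⊗ id` for `k ≥ 1`, and the map for `k = 0` is forced by the one for `k = 1`. -/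
def filterShift : ∀ k, InnerMap ((RightHilbertModule.self A).tensorPow M k)
    ((filterLimit M m hm).tensor M)
  | 0 => ((filterLimitMap M m hm 0).tensorId M).comp (filterMap M m hm)
  | k + 1 => (filterLimitMap M m hm k).tensorId M

lemma filterShift_comp_tensorIdPow : ∀ k,
    (filterShift M m hm (k + 1)).comp ((filterMap M m hm).tensorIdPow k) = filterShift M m hm k
  | 0 => rfl
  | k + 1 => (InnerMap.tensorId_comp _ _ M).symm.trans
      (congrArg (InnerMap.tensorId · M) (filterLimitMap_comp_tensorIdPow k))

variable (M m hm) in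
/-- The map `R : M_∞ → M_∞ ⊗_A M` such that `R ∘ ι^{k+1} = ι^k ⊗ id`. -/
def filterLimitShift : InnerMap (filterLimit M m hm) ((filterLimit M m hm).tensor M) :=
  limitLift (filterShift M m hm) filterShift_comp_tensorIdPow

lemma filterLimitShift_comp_filterLimitMap (k : ℕ) :
    (filterLimitShift M m hm).comp (filterLimitMap M m hm (k + 1)) =
      (filterLimitMap M m hm k).tensorId M :=
  limitLift_comp_limitMap _ filterShift_comp_tensorIdPow (k + 1)

lemma filterLimitShift_surjective : Function.Surjective (filterLimitShift M m hm) := by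
  have hR := (filterLimitShift M m hm).isClosed_range
  refine tensor_induction (p := (· ∈ Set.range (filterLimitShift M m hm))) hR ?_ fun x n => ?_
  · rintro _ _ ⟨z, rfl⟩ ⟨w, rfl⟩
    exact ⟨z + w, map_add _ _ _⟩
  · refine filterLimit_induction (p := fun x => tmul x n ∈ Set.range (filterLimitShift M m hm))
      (hR.preimage (continuous_tmul_left n)) (fun k x => ?_) x
    rw [← InnerMap.tensorId_tmul, ← filterLimitShift_comp_filterLimitMap]
    exact ⟨_, rfl⟩

/-- The inner-product preserving map `a ↦ φ · a`. -/
def InnerMap.ofUnit (φ : X) (hφ : X.inner φ φ = 1) :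
    InnerMap (RightHilbertModule.self A) X where
  toFun a := φ <• (show A from a)
  map_add' a b := add_smul (MulOpposite.op (show A from a)) (MulOpposite.op (show A from b)) φ
  map_smul' b a := mul_smul b (MulOpposite.op (show A from a)) φ
  inner_map a b := by
    have h : X.inner (φ <• (show A from a)) φ = star (show A from a) * X.inner φ φ :=
      X.pre.inner_smul_left _ _ _
    rw [X.inner_smul_right, h, hφ, mul_one]
    rfl

lemma InnerMap.ofUnit_selfOne (φ : X) (hφ : X.inner φ φ = 1) :
    InnerMap.ofUnit φ hφ (selfOne A) = φ :=
  one_smul Aᵐᵒᵖ φ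

/-- The maps `q_k : M^{⊗ k} → X` with `q_0 (a) = φ · a` and `D ∘ q_{k+1} = q_k ⊗ id`. -/
def realizationMap (D : InnerEquiv X (X.tensor M)) (φ : X) (hφ : X.inner φ φ = 1) :
    ∀ k, InnerMap ((RightHilbertModule.self A).tensorPow M k) X
  | 0 => InnerMap.ofUnit φ hφ
  | k + 1 => D.symm.toInnerMap.comp ((realizationMap D φ hφ k).tensorId M)

variable {D : InnerEquiv X (X.tensor M)} {φ : X}

lemma IsScalingFunction.inner_self (h : IsScalingFunction m D φ) : X.inner φ φ = 1 := h.1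

lemma IsScalingFunction.apply_eq_tmul (h : IsScalingFunction m D φ) : D φ = tmul φ m := h.2

lemma comp_realizationMap_succ (hφ : X.inner φ φ = 1) (k : ℕ) :
    D.toInnerMap.comp (realizationMap D φ hφ (k + 1)) = (realizationMap D φ hφ k).tensorId M :=
  InnerMap.ext fun _ => D.apply_symm_apply _

lemma realizationMap_comp_tensorIdPow (h : IsScalingFunction m D φ) (k : ℕ) :
    (realizationMap D φ h.inner_self (k + 1)).comp ((filterMap M m hm).tensorIdPow k) =
      realizationMap D φ h.inner_self k := by
  apply D.toInnerMap_comp_injective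
  change (D.toInnerMap.comp (realizationMap D φ h.inner_self (k + 1))).comp _ = _
  rw [comp_realizationMap_succ]
  induction k with
  | zero =>
    refine InnerMap.self_ext ?_
    calc (InnerMap.ofUnit φ h.inner_self).tensorId M (tmul (selfOne A) (m <• (1 : A)))
        = tmul φ m := by
          rw [InnerMap.tensorId_tmul, InnerMap.ofUnit_selfOne, MulOpposite.op_one, one_smul]
      _ = D (InnerMap.ofUnit φ h.inner_self (selfOne A)) := by
          rw [InnerMap.ofUnit_selfOne, h.apply_eq_tmul]
  | succ k ih =>
    rw [comp_realizationMap_succ]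
    refine (InnerMap.tensorId_comp _ _ M).symm.trans (congrArg (InnerMap.tensorId · M) ?_)
    apply D.toInnerMap_comp_injective
    rw [← ih, ← comp_realizationMap_succ]
    rfl

lemma exists_isRealization (h : IsScalingFunction m D φ) :
    ∃ R Q, IsRealization (hm := hm) D φ R Q := by
  let Q : InnerMap (filterLimit M m hm) X :=
    limitLift (realizationMap D φ h.inner_self) (realizationMap_comp_tensorIdPow h)
  have hQ (k : ℕ) : Q.comp (filterLimitMap M m hm k) = realizationMap D φ h.inner_self k :=
    limitLift_comp_limitMap _ _ k
  have hDQ : D.toInnerMap.comp Q = (Q.tensorId M).comp (filterLimitShift M m hm) := by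
    refine filterLimit_ext fun k => ?_
    change D.toInnerMap.comp (Q.comp _) = (Q.tensorId M).comp ((filterLimitShift M m hm).comp _)
    rw [hQ, comp_realizationMap_succ, filterLimitShift_comp_filterLimitMap, ← hQ k]
    exact InnerMap.tensorId_comp _ _ M
  refine ⟨(filterLimitShift M m hm).equivOfSurjective filterLimitShift_surjective, Q, fun k =>
    DFunLike.congr_fun (filterLimitShift_comp_filterLimitMap k), ?_, DFunLike.congr_fun hDQ⟩
  exact (DFunLike.congr_fun (hQ 0) (selfOne A)).trans (InnerMap.ofUnit_selfOne φ h.inner_self)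

lemma IsRealization.comp_filterLimitMap
    {R : InnerEquiv (filterLimit M m hm) ((filterLimit M m hm).tensor M)}
    {Q : InnerMap (filterLimit M m hm) X} (h : IsRealization D φ R Q) (hφ : X.inner φ φ = 1)
    (k : ℕ) : Q.comp (filterLimitMap M m hm k) = realizationMap D φ hφ k := by
  induction k with
  | zero => exact InnerMap.self_ext (h.base.trans (InnerMap.ofUnit_selfOne φ hφ).symm)
  | succ k ih =>
    apply D.toInnerMap_comp_injective
    rw [comp_realizationMap_succ, ← ih]
    refine Eq.trans (InnerMap.ext fun z => ?_) (InnerMap.tensorId_comp _ _ M).symm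
    exact (h.intertwine _).trans (congrArg (Q.tensorId M) (h.shift k z))

theorem existsUnique_isRealization (h : IsScalingFunction m D φ) :
    ∃! p : InnerEquiv (filterLimit M m hm) ((filterLimit M m hm).tensor M) ×
      InnerMap (filterLimit M m hm) X, IsRealization D φ p.1 p.2 := by
  obtain ⟨R, Q, hRQ⟩ := exists_isRealization (hm := hm) h
  refine ⟨(R, Q), hRQ, fun p hp => Prod.ext ?_ ?_⟩
  · have hR : p.1.toInnerMap = R.toInnerMap := filterLimit_ext fun k =>
      InnerMap.ext fun z => (hp.shift k z).trans (hRQ.shift k z).symm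
    exact InnerEquiv.ext fun z => DFunLike.congr_fun hR z
  · exact filterLimit_ext fun k =>
      (hp.comp_filterLimitMap h.inner_self _).trans (hRQ.comp_filterLimitMap h.inner_self _).symm

end Realization

section PositiveSums

lemma mem_closure_range_sum_of_hasSum {A ι : Type*} [AddCommMonoid A] [TopologicalSpace A]
    {f : ι → A} {c : A} (h : HasSum f c) :
    c ∈ closure (Set.range fun s : Finset ι => ∑ i ∈ s, f i) :=
  mem_closure_of_tendsto h (.of_forall Set.mem_range_self)

variable {A : Type*} [CStarAlgebra A] [PartialOrder A] [StarOrderedRing A] {ι κ : Type*}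

lemma hasSum_of_nonneg_of_mem_closure {f : ι → A} {c : A} (hf : ∀ i, 0 ≤ f i)
    (hle : ∀ s : Finset ι, ∑ i ∈ s, f i ≤ c)
    (hc : c ∈ closure (Set.range fun s : Finset ι => ∑ i ∈ s, f i)) : HasSum f c := by
  classical
  rw [HasSum, SummationFilter.unconditional_filter, Metric.tendsto_atTop]
  intro ε hε
  obtain ⟨_, ⟨s, rfl⟩, hs⟩ := Metric.mem_closure_iff.1 hc ε hε
  refine ⟨s, fun t hst => ?_⟩
  rw [dist_eq_norm] at hs
  rw [dist_comm, dist_eq_norm]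
  refine (CStarAlgebra.norm_le_norm_of_nonneg_of_le (sub_nonneg.2 (hle t)) ?_).trans_lt hs
  exact sub_le_sub_left (Finset.sum_le_sum_of_subset_of_nonneg hst fun i _ _ => hf i) c

lemma hasSum_prod_of_nonneg {f : ι × κ → A} {b : ι → A} {c : A} (hf : ∀ p, 0 ≤ f p)
    (hb : ∀ i, HasSum (fun j => f (i, j)) (b i)) (hc : HasSum b c) : HasSum f c := by
  classical
  refine hasSum_of_nonneg_of_mem_closure hf (fun s => ?_) ?_
  · calc ∑ p ∈ s, f p ≤ ∑ p ∈ s.image Prod.fst ×ˢ s.image Prod.snd, f p :=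
          Finset.sum_le_sum_of_subset_of_nonneg Finset.subset_product fun p _ _ => hf p
      _ = ∑ i ∈ s.image Prod.fst, ∑ j ∈ s.image Prod.snd, f (i, j) := Finset.sum_product _ _ _
      _ ≤ ∑ i ∈ s.image Prod.fst, b i :=
          Finset.sum_le_sum fun i _ => sum_le_hasSum _ (fun j _ => hf (i, j)) (hb i)
      _ ≤ c := sum_le_hasSum _ (fun i _ => (hb i).nonneg fun j => hf (i, j)) hc
  · rw [← isClosed_closure.closure_eq]
    refine closure_mono ?_ (mem_closure_range_sum_of_hasSum hc)
    rintro _ ⟨s, rfl⟩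
    refine mem_closure_of_tendsto (hasSum_sum fun i _ => hb i) (.of_forall fun t => ?_)
    exact ⟨s ×ˢ t, (Finset.sum_product _ _ _).trans Finset.sum_comm⟩

end PositiveSums

section Forms

variable {A E : Type u} [CStarAlgebra A] [PartialOrder A] [AddCommGroup E]
  [Module ℂ E] [Module Aᵐᵒᵖ E] [IsScalarTower ℂ Aᵐᵒᵖ E] (P : PreHilbertModule A E)

lemma PreHilbertModule.parallelogram (x y : E) :
    P.inner (x + y) (x + y) + P.inner (x - y) (x - y) = 2 • (P.inner x x + P.inner y y) := by
  simp only [inner_add_left, inner_sub_left, inner_sub_right, P.inner_add_right]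
  abel

lemma PreHilbertModule.polarization (x y : E) :
    P.inner x y = (4⁻¹ : ℂ) • (P.inner (x + y) (x + y) - P.inner (x - y) (x - y)
      - Complex.I • P.inner (x + Complex.I • y) (x + Complex.I • y)
      + Complex.I • P.inner (x - Complex.I • y) (x - Complex.I • y)) := by
  simp only [inner_add_left, inner_sub_left, inner_sub_right, inner_csmul_left,
    inner_csmul_right, P.inner_add_right, Complex.star_def, Complex.conj_I, smul_add, smul_sub,
    smul_smul]
  match_scalars <;> ring_nf <;> simp only [Complex.I_sq] <;> norm_num

end Forms

section Parseval

variable {A : Type u} [CStarAlgebra A] [PartialOrder A]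
  {X Z : RightHilbertModule A} {M : CStarCorrespondence A} {ι κ : Type*} {e : ι → X}

/-- The Parseval identity for the vector `y` and the family `e`. -/
def SatisfiesParseval (e : ι → X) (y : X) : Prop :=
  HasSum (fun i => X.inner y (e i) * X.inner (e i) y) (X.inner y y)

/-- The contraction `n ⊗ z ↦ ⟨x, f z⟩ • n`; up to identifications it is the adjoint of `n ↦ x ⊗ n`
restricted to the range of `f ⊗ id`. -/
def InnerMap.contract (f : InnerMap Z X) (M : CStarCorrespondence A) (x : X) :
    M ⊗[ℂ] Z →ₗ[ℂ] M :=
  TensorProduct.lift <| LinearMap.mk₂ ℂ (fun (n : M) (z : Z) => X.inner x (f z) • n)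
    (fun n n' z => smul_add _ _ _)
    (fun c n z => smul_comm _ _ _)
    (fun n z z' => by rw [map_add, X.inner_add_right, add_smul])
    (fun c n z => by
      have h : X.inner x (c • f z) = c • X.inner x (f z) := X.pre.inner_csmul_right _ _ _
      rw [f.map_complex_smul, h, smul_assoc])

lemma InnerMap.contract_tmul (f : InnerMap Z X) (x : X) (n : M) (z : Z) :
    f.contract M x (n ⊗ₜ z) = X.inner x (f z) • n := rfl

variable [StarOrderedRing A]

/-- The rank-one form `⟨x, e⟩ ⟨e, y⟩`, whose diagonal values are the terms of the Parseval
identity. -/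
def RightHilbertModule.rankOne (e : X) : PreHilbertModule A X where
  inner x y := X.inner x e * X.inner e y
  inner_add_right x y z := by rw [X.inner_add_right, mul_add]
  inner_smul_right x y a := by rw [X.inner_smul_right, mul_assoc]
  star_inner x y := by rw [star_mul, X.star_inner, X.star_inner]
  inner_self_nonneg x := by rw [← X.star_inner e x]; exact star_mul_self_nonneg _

lemma SatisfiesParseval.hasSum_inner {f : InnerMap Z X} (h : ∀ z, SatisfiesParseval e (f z))
    (z w : Z) : HasSum (fun i => X.inner (f z) (e i) * X.inner (e i) (f w)) (Z.inner z w) := by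
  have hdiag (z : Z) : HasSum (fun i => (rankOne (e i)).inner (f z) (f z)) (Z.inner z z) := by
    rw [← f.inner_apply]
    exact h z
  change HasSum (fun i => (rankOne (e i)).inner (f z) (f w)) (Z.pre.inner z w)
  simp only [fun i => (rankOne (e i)).polarization (f z) (f w), Z.pre.polarization z w,
    ← f.map_complex_smul, ← map_add, ← map_sub]
  exact ((((hdiag _).sub (hdiag _)).sub ((hdiag _).const_smul _)).add
    ((hdiag _).const_smul _)).const_smul _

lemma sum_rankOne_le_inner_of_dense {f : InnerMap Z X}
    (h : Dense {z | SatisfiesParseval e (f z)}) (s : Finset ι) (z : Z) :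
    ∑ i ∈ s, (rankOne (e i)).inner (f z) (f z) ≤ X.inner (f z) (f z) := by
  refine closure_minimal (t := {z | ∑ i ∈ s, (rankOne (e i)).inner (f z) (f z) ≤
    X.inner (f z) (f z)}) (fun w hw => ?_) (isClosed_le ?_ ?_) (h z)
  · exact sum_le_hasSum s (fun i _ => (rankOne (e i)).inner_self_nonneg (f w)) hw
  · refine continuous_finsetSum _ fun i _ => Continuous.mul ?_ ?_ <;> fun_prop
  · fun_prop

/-- The parallelogram law for the Bessel defect, which is a positive form. -/
lemma inner_sub_sum_rankOne_le {f : InnerMap Z X} {s : Finset ι}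
    (h : ∀ z, ∑ i ∈ s, (rankOne (e i)).inner (f z) (f z) ≤ X.inner (f z) (f z)) (z w : Z) :
    X.inner (f z) (f z) - ∑ i ∈ s, (rankOne (e i)).inner (f z) (f z) ≤
      2 • (X.inner (f w) (f w) - ∑ i ∈ s, (rankOne (e i)).inner (f w) (f w) +
        X.inner (f (z - w)) (f (z - w))) := by
  let g (x : Z) : A := X.inner (f x) (f x) - ∑ i ∈ s, (rankOne (e i)).inner (f x) (f x)
  have hg : g (w + (z - w)) + g (w - (z - w)) = 2 • (g w + g (z - w)) := by
    have hX := X.pre.parallelogram (f w) (f (z - w))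
    have hs := Finset.sum_congr rfl fun i (_ : i ∈ s) =>
      (rankOne (e i)).parallelogram (f w) (f (z - w))
    rw [Finset.sum_add_distrib, ← Finset.smul_sum, Finset.sum_add_distrib] at hs
    simp only [← map_add f, ← map_sub f] at hX hs
    change X.inner _ _ + X.inner _ _ = 2 • (X.inner _ _ + X.inner _ _) at hX
    simp only [g, sub_add_sub_comm, hX, hs, smul_sub]
  rw [add_sub_cancel] at hg
  calc g z ≤ g z + g (w - (z - w)) := le_add_of_nonneg_right (sub_nonneg.2 (h _))
    _ = 2 • (g w + g (z - w)) := hg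
    _ ≤ 2 • (g w + X.inner (f (z - w)) (f (z - w))) := by
      gcongr
      exact sub_le_self _ (Finset.sum_nonneg fun i _ => (rankOne (e i)).inner_self_nonneg _)

lemma SatisfiesParseval.of_dense {f : InnerMap Z X} (h : Dense {z | SatisfiesParseval e (f z)})
    (z : Z) : SatisfiesParseval e (f z) := by
  have hbessel := sum_rankOne_le_inner_of_dense h
  refine hasSum_of_nonneg_of_mem_closure (fun i => (rankOne (e i)).inner_self_nonneg (f z))
    (fun s => hbessel s z) (Metric.mem_closure_iff.2 fun ε hε => ?_)
  have hε' : 0 < ε / 4 := by positivity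
  have hcont : Continuous fun w => X.inner (f (z - w)) (f (z - w)) := by fun_prop
  obtain ⟨w, hw, hzw⟩ := h.exists_mem_open (isOpen_lt hcont.norm continuous_const)
    ⟨z, show ‖_‖ < ε / 4 by
      rwa [sub_self, map_zero, show X.inner 0 0 = 0 from X.pre.inner_zero_right 0, norm_zero]⟩
  obtain ⟨_, ⟨s, rfl⟩, hs⟩ := Metric.mem_closure_iff.1 (mem_closure_range_sum_of_hasSum hw) _ hε'
  refine ⟨_, ⟨s, rfl⟩, ?_⟩
  rw [dist_eq_norm] at hs ⊢
  let a := X.inner (f w) (f w) - ∑ i ∈ s, (rankOne (e i)).inner (f w) (f w)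
  let b := X.inner (f (z - w)) (f (z - w))
  have ha : ‖a‖ < ε / 4 := hs
  have hb : ‖b‖ < ε / 4 := hzw
  calc ‖X.inner (f z) (f z) - ∑ i ∈ s, (rankOne (e i)).inner (f z) (f z)‖
      ≤ ‖2 • (a + b)‖ := CStarAlgebra.norm_le_norm_of_nonneg_of_le (sub_nonneg.2 (hbessel s z))
        (inner_sub_sum_rankOne_le (hbessel s) z w)
    _ ≤ 2 * (‖a‖ + ‖b‖) := (norm_nsmul_le).trans
        (mul_le_mul_of_nonneg_left (norm_add_le a b) (Nat.cast_nonneg 2))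
    _ < ε := by linarith

lemma InnerMap.inner_tmul_tensorId_of (f : InnerMap Z X) (x : X) (n : M) (z : M ⊗[ℂ] Z) :
    (X.tensor M).inner (tmul x n) (f.tensorId M ((Z.tensorPre M).of z)) =
      M.inner n (f.contract M x z) := by
  induction z using TensorProduct.induction_on with
  | zero =>
    rw [map_zero, map_zero]
    exact ((congrArg _ (map_zero (f.tensorId M))).trans
      ((X.tensor M).pre.inner_zero_right _)).trans (M.pre.inner_zero_right n).symm
  | add z w hz hw =>
    rw [map_add, map_add, M.inner_add_right, ← hz, ← hw]
    exact (congrArg _ (map_add (f.tensorId M) _ _)).trans ((X.tensor M).inner_add_right _ _ _)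
  | tmul m z =>
    change (X.tensor M).inner (tmul x n) (f.tensorId M (tmul z m)) = _
    rw [InnerMap.tensorId_tmul, inner_tmul_right, contract_tmul]

lemma SatisfiesParseval.hasSum_inner_contract_tmul {f : InnerMap Z X}
    (h : ∀ z, SatisfiesParseval e (f z)) (n n' : M) (z z' : Z) :
    HasSum (fun i => M.inner (f.contract M (e i) (n ⊗ₜ z)) (f.contract M (e i) (n' ⊗ₜ z')))
      (Z.tensorForm M (n ⊗ₜ z) (n' ⊗ₜ z')) := by
  let g : A →+ A := AddMonoidHom.mk' (fun a => M.inner n (a • n')) fun a b => by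
    rw [add_smul, M.inner_add_right]
  have hg : Continuous g :=
    M.toRightHilbertModule.continuous_inner continuous_const (M.continuous_smul_left n')
  refine ((SatisfiesParseval.hasSum_inner h z z').map g hg).congr_fun fun i => ?_
  change M.inner (X.inner (e i) (f z) • n) (X.inner (e i) (f z') • n') =
    M.inner n ((X.inner (f z) (e i) * X.inner (e i) (f z')) • n')
  rw [M.inner_left_smul, X.star_inner, smul_smul]

lemma SatisfiesParseval.hasSum_inner_contract {f : InnerMap Z X}
    (h : ∀ z, SatisfiesParseval e (f z)) (z w : M ⊗[ℂ] Z) :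
    HasSum (fun i => M.inner (f.contract M (e i) z) (f.contract M (e i) w))
      (Z.tensorForm M z w) := by
  change HasSum (fun i => M.pre.inner _ _) _
  induction z using TensorProduct.induction_on with
  | zero =>
    simpa only [map_zero, LinearMap.zero_apply, M.pre.inner_zero_left] using hasSum_zero
  | add z z' hz hz' =>
    simpa only [map_add, LinearMap.add_apply, M.pre.inner_add_left] using hz.add hz'
  | tmul n z =>
    induction w using TensorProduct.induction_on with
    | zero => simpa only [map_zero, M.pre.inner_zero_right] using hasSum_zero
    | add w w' hw hw' => simpa only [map_add, M.pre.inner_add_right] using hw.add hw'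
    | tmul n' z' => exact hasSum_inner_contract_tmul h n n' z z'

theorem SatisfiesParseval.tensorId {f : InnerMap Z X} (he : ∀ z, SatisfiesParseval e (f z))
    {m : κ → M} (hm : ∀ n, SatisfiesParseval (X := M.toRightHilbertModule) m n)
    (w : Z.tensor M) :
    SatisfiesParseval (fun p : ι × κ => (tmul (e p.1) (m p.2) : X.tensor M))
      (f.tensorId M w) := by
  refine of_dense ((Z.tensorPre M).denseRange_of.mono ?_) w
  rintro _ ⟨z, rfl⟩
  refine hasSum_prod_of_nonneg (fun p => (rankOne _).inner_self_nonneg _) (fun i => ?_)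
    (b := fun i => M.inner (f.contract M (e i) z) (f.contract M (e i) z)) ?_
  · have hinner (j : κ) : (X.tensor M).inner (tmul (e i) (m j))
        (f.tensorId M ((Z.tensorPre M).of z)) = M.inner (m j) (f.contract M (e i) z) :=
      f.inner_tmul_tensorId_of (e i) (m j) z
    refine (hm (f.contract M (e i) z)).congr_fun fun j => ?_
    refine congrArg₂ (· * ·) ?_ (hinner j)
    exact ((X.tensor M).star_inner _ _).symm.trans ((congrArg star (hinner j)).trans
      (M.star_inner _ _))
  · have hsum := hasSum_inner_contract he z z (M := M)
    have hself : Z.tensorForm M z z = (X.tensor M).inner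
        (f.tensorId M ((Z.tensorPre M).of z)) (f.tensorId M ((Z.tensorPre M).of z)) :=
      ((Z.tensorPre M).inner_of z z).symm.trans ((f.tensorId M).inner_apply _ _).symm
    rwa [hself] at hsum

end Parseval

namespace FrameIndex

variable {J : Type*} {j₀ : J}

open Classical in
/-- Appending an entry to a tuple; the empty tuple stands for all tuples `(j₀, …, j₀)`. -/
def snoc : FrameIndex j₀ → J → FrameIndex j₀
  | none, j => if h : j = j₀ then none else some ⟨0, fun _ => j, h⟩
  | some ⟨k, j⟩, l => some ⟨k + 1, Fin.snoc (α := fun _ => J) j.1 l, by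
      have h0 : (0 : Fin (k + 2)) = (0 : Fin (k + 1)).castSucc := rfl
      rw [h0, Fin.snoc_castSucc]
      exact j.2⟩

lemma snoc_none_self : snoc (none : FrameIndex j₀) j₀ = none := dif_pos rfl

lemma snoc_none_of_ne {j : J} (h : j ≠ j₀) :
    snoc (none : FrameIndex j₀) j = some ⟨0, fun _ => j, h⟩ := dif_neg h

lemma some_zero_eq_snoc (j : Fin 1 → J) (hj : j 0 ≠ j₀) :
    (some ⟨0, j, hj⟩ : FrameIndex j₀) = snoc none (j 0) := by
  rw [snoc_none_of_ne hj]
  congr 3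
  ext l
  rw [Subsingleton.elim l 0]

lemma some_succ_eq_snoc {k : ℕ} (j : Fin (k + 2) → J) (hj : j 0 ≠ j₀) :
    (some ⟨k + 1, j, hj⟩ : FrameIndex j₀) =
      snoc (some ⟨k, fun l => j l.castSucc, hj⟩) (j (Fin.last _)) := by
  simp only [snoc]
  congr 3
  exact (Fin.snoc_init_self (α := fun _ => J) j).symm

lemma snoc_induction {p : FrameIndex j₀ → Prop} (h0 : p none) (h : ∀ i j, p i → p (snoc i j))
    (i : FrameIndex j₀) : p i := by
  rcases i with _ | ⟨k, j, hj⟩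
  · exact h0
  induction k with
  | zero => rw [some_zero_eq_snoc]; exact h _ _ h0
  | succ k ih => rw [some_succ_eq_snoc]; exact h _ _ (ih _ hj)

lemma snoc_injective : Function.Injective fun p : FrameIndex j₀ × J => snoc p.1 p.2 := by
  rintro ⟨_ | ⟨k, j, hj⟩, l⟩ ⟨_ | ⟨k', j', hj'⟩, l'⟩ h
  · by_cases hl : l = j₀ <;> by_cases hl' : l' = j₀
    · rw [hl, hl']
    · simp [snoc, hl, hl'] at h
    · simp [snoc, hl, hl'] at h
    · simp only [snoc_none_of_ne hl, snoc_none_of_ne hl', Option.some.injEq, Sigma.mk.injEq,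
        heq_eq_eq, true_and, Subtype.mk.injEq] at h
      rw [congrFun h 0]
  · by_cases hl : l = j₀ <;> simp [snoc, hl] at h
  · by_cases hl' : l' = j₀ <;> simp [snoc, hl'] at h
  · simp only [snoc, Option.some.injEq, Sigma.mk.injEq, Nat.add_right_cancel_iff] at h
    obtain ⟨rfl, h⟩ := h
    simp only [heq_eq_eq, Subtype.mk.injEq] at h
    obtain ⟨rfl, rfl⟩ := Fin.snoc_injective2 (α := fun _ => J) h
    rfl

variable (j₀) in
/-- Appending an entry, as a bijection. -/
def snocEquiv : FrameIndex j₀ × J ≃ FrameIndex j₀ :=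
  Equiv.ofBijective (fun p => snoc p.1 p.2) ⟨snoc_injective, snoc_induction
    (p := fun i => ∃ q : FrameIndex j₀ × J, snoc q.1 q.2 = i) ⟨(none, j₀), snoc_none_self⟩
    fun i j _ => ⟨(i, j), rfl⟩⟩

lemma snocEquiv_apply (p : FrameIndex j₀ × J) : snocEquiv j₀ p = snoc p.1 p.2 := rfl

end FrameIndex

section Frame

variable {A : Type u} [CStarAlgebra A] [PartialOrder A] {X : RightHilbertModule A}
  {ι : Type*} {e : ι → X}

lemma IsOrthonormalFamily.inner_sub_sum_self (he : IsOrthonormalFamily e) (s : Finset ι) (y : X) :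
    X.inner (y - ∑ i ∈ s, e i <• X.inner (e i) y) (y - ∑ i ∈ s, e i <• X.inner (e i) y) =
      X.inner y y - ∑ i ∈ s, X.inner y (e i) * X.inner (e i) y := by
  classical
  change X.pre.inner _ _ = X.pre.inner _ _ - _
  set w := ∑ i ∈ s, e i <• X.inner (e i) y with hw
  have hmul (x : X) (i : ι) : X.pre.inner x (e i <• X.inner (e i) y) =
    X.inner x (e i) * X.inner (e i) y := X.inner_smul_right _ _ _
  have hcoeff (i : ι) (hi : i ∈ s) : X.pre.inner (e i) w = X.pre.inner (e i) y := by
    rw [hw, X.pre.inner_sum_right, Finset.sum_eq_single_of_mem i hi fun j _ hj => by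
      rw [hmul, he.2 i j hj.symm, zero_mul], hmul, he.1 i, one_mul]
    rfl
  have hperp : X.pre.inner w (y - w) = 0 := by
    conv_lhs => rw [hw, X.pre.inner_sum_left]
    refine Finset.sum_eq_zero fun i hi => ?_
    rw [X.pre.inner_smul_left, X.pre.inner_sub_right, hcoeff i hi, sub_self, mul_zero]
  rw [X.pre.inner_sub_left, hperp, sub_zero, X.pre.inner_sub_right, hw, X.pre.inner_sum_right]
  simp only [hmul]

lemma IsOrthonormalFamily.mem_closure_span (he : IsOrthonormalFamily e) {y : X}
    (hy : SatisfiesParseval e y) :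
    y ∈ closure (Submodule.span Aᵐᵒᵖ (Set.range e) : Set X) := by
  refine Metric.mem_closure_iff.2 fun ε hε => ?_
  obtain ⟨_, ⟨s, rfl⟩, hs⟩ :=
    Metric.mem_closure_iff.1 (mem_closure_range_sum_of_hasSum hy) _ (sq_pos_of_pos hε)
  refine ⟨∑ i ∈ s, e i <• X.inner (e i) y, Submodule.sum_mem _ fun i _ =>
    Submodule.smul_mem _ _ (Submodule.subset_span ⟨i, rfl⟩), ?_⟩
  rw [dist_eq_norm, X.norm_eq, he.inner_sub_sum_self, ← dist_eq_norm]
  exact (Real.sqrt_lt' hε).2 hs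

lemma satisfiesParseval_op_smul {i₀ : ι} (h0 : X.inner (e i₀) (e i₀) = 1)
    (horth : ∀ i ≠ i₀, X.inner (e i) (e i₀) = 0) (a : A) : SatisfiesParseval e (e i₀ <• a) := by
  have hsingle := hasSum_single (f := fun i => X.inner (e i₀ <• a) (e i) *
    X.inner (e i) (e i₀ <• a)) i₀ fun i hi => by
      rw [X.inner_smul_right, horth i hi, zero_mul, mul_zero]
  have hself : X.inner (e i₀) (e i₀ <• a) = a := by rw [X.inner_smul_right, h0, one_mul]
  have hvalue : X.inner (e i₀ <• a) (e i₀) * X.inner (e i₀) (e i₀ <• a) =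
      X.inner (e i₀ <• a) (e i₀ <• a) := by rw [hself, ← X.inner_smul_right]
  rwa [hvalue] at hsingle

lemma IsParsevalFrame.inner_eq_zero_of_ne [StarOrderedRing A] {V : Submodule Aᵐᵒᵖ X}
    (h : IsParsevalFrame V e) {i i₀ : ι} (h0 : X.inner (e i₀) (e i₀) = 1) (hi : i ≠ i₀) :
    X.inner (e i) (e i₀) = 0 := by
  classical
  have hle := sum_le_hasSum {i₀, i} (fun i _ => (rankOne (e i)).inner_self_nonneg (e i₀))
    (h.2 (e i₀) (h.1 i₀))
  rw [Finset.sum_pair hi.symm] at hle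
  change X.inner (e i₀) (e i₀) * X.inner (e i₀) (e i₀) +
    X.inner (e i₀) (e i) * X.inner (e i) (e i₀) ≤ _ at hle
  rw [h0, mul_one, add_le_iff_nonpos_right,
    ← X.star_inner (e i) (e i₀)] at hle
  exact (CStarRing.star_mul_self_eq_zero_iff _).1 (le_antisymm hle (star_mul_self_nonneg _))

end Frame

open FrameIndex

section DilationFamily

variable {A : Type u} [CStarAlgebra A] [PartialOrder A] [StarOrderedRing A]
  {M : CStarCorrespondence A} {J : Type*} {j₀ : J} {m : J → M} {X : RightHilbertModule A}
  {D : InnerEquiv X (X.tensor M)} {φ : X} {e : FrameIndex j₀ → X}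

/-- The family `e` starts with `φ`, and `D` takes the vector indexed by `(j₁, …, jₖ, j)` to the
tensor product of the one indexed by `(j₁, …, jₖ)` with `m j`. This recursion determines `e`
without mentioning the powers of `D`. -/
structure IsDilationFamily (D : InnerEquiv X (X.tensor M)) (φ : X) (m : J → M)
    (e : FrameIndex j₀ → X) : Prop where
  none_eq : e none = φ
  apply_snoc : ∀ i j, D (e (snoc i j)) = tmul (e i) (m j)

namespace IsDilationFamily

lemma inner_snoc (h : IsDilationFamily D φ m e) (i i' : FrameIndex j₀) (j j' : J) :
    X.inner (e (snoc i j)) (e (snoc i' j')) = M.inner (m j) (X.inner (e i) (e i') • m j') := by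
  rw [← D.toInnerMap.inner_apply, ← inner_tmul_right, ← h.apply_snoc, ← h.apply_snoc]
  rfl

lemma inner_none_eq_zero (h : IsDilationFamily D φ m e) (hφ : X.inner φ φ = 1)
    (hm : ∀ j ≠ j₀, M.inner (m j) (m j₀) = 0) {i : FrameIndex j₀} (hi : i ≠ none) :
    X.inner (e i) (e none) = 0 := by
  induction i using snoc_induction with
  | h0 => exact absurd rfl hi
  | h i j ih =>
    have hstep := h.inner_snoc i none j j₀
    rw [snoc_none_self] at hstep
    rw [hstep]
    by_cases hne : i = none
    · subst hne
      rw [h.none_eq, hφ, one_smul]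
      exact hm j fun hj => hi (by rw [hj, snoc_none_self])
    · rw [ih hne, zero_smul]
      exact M.pre.inner_zero_right _

lemma isOrthonormalFamily (h : IsDilationFamily D φ m e) (hφ : X.inner φ φ = 1)
    (hm : IsOrthonormalFamily (X := M.toRightHilbertModule) m) : IsOrthonormalFamily e := by
  have hnone {i : FrameIndex j₀} (hi : i ≠ none) : X.inner (e i) (e none) = 0 :=
    h.inner_none_eq_zero hφ (fun j hj => hm.2 j j₀ hj) hi
  have hself (i : FrameIndex j₀) : X.inner (e i) (e i) = 1 := by
    induction i using snoc_induction with
    | h0 => rw [h.none_eq, hφ]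
    | h i j ih => rw [h.inner_snoc, ih, one_smul]; exact hm.1 j
  refine ⟨hself, fun i i' => ?_⟩
  induction i using snoc_induction generalizing i' with
  | h0 => intro hi; rw [← X.star_inner, hnone hi.symm, star_zero]
  | h i j ih =>
    obtain ⟨⟨q, l⟩, rfl⟩ := (snocEquiv j₀).surjective i'
    intro hne
    rw [snocEquiv_apply] at hne ⊢
    rw [h.inner_snoc]
    by_cases hq : i = q
    · subst hq
      rw [hself, one_smul]
      exact hm.2 j l fun hjl => hne (by rw [hjl])
    · rw [ih q hq, zero_smul]
      exact M.pre.inner_zero_right _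

lemma satisfiesParseval_realizationMap (h : IsDilationFamily D φ m e) (hφ : X.inner φ φ = 1)
    (hm : M.inner (m j₀) (m j₀) = 1) (hframe : IsParsevalFrame (X := M.toRightHilbertModule) ⊤ m)
    (k : ℕ) (z : (RightHilbertModule.self A).tensorPow M k) :
    SatisfiesParseval e (realizationMap D φ hφ k z) := by
  induction k with
  | zero =>
    have hnone := satisfiesParseval_op_smul (e := e) (i₀ := none) (by rw [h.none_eq, hφ])
      (fun i hi => h.inner_none_eq_zero hφ (fun j hj => hframe.inner_eq_zero_of_ne hm hj) hi) z
    rwa [h.none_eq] at hnone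
  | succ k ih =>
    have htensor := SatisfiesParseval.tensorId ih (fun n => hframe.2 n trivial) z
    have hD (x y : X) : X.inner x y = (X.tensor M).inner (D x) (D y) := (D.inner_map x y).symm
    have happly : D (realizationMap D φ hφ (k + 1) z) =
        (realizationMap D φ hφ k).tensorId M z :=
        DFunLike.congr_fun (comp_realizationMap_succ hφ k) z
    rw [SatisfiesParseval, hD, happly, ← (snocEquiv j₀).hasSum_iff]
    refine htensor.congr_fun fun p => ?_
    rw [Function.comp_apply, hD _ (e _), hD (e _), happly, snocEquiv_apply, h.apply_snoc]

end IsDilationFamily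

variable {hm : M.inner (m j₀) (m j₀) = 1}
  {R : InnerEquiv (filterLimit M (m j₀) hm) ((filterLimit M (m j₀) hm).tensor M)}
  {Q : InnerMap (filterLimit M (m j₀) hm) X}

namespace IsRealization

lemma mem_range (hQ : IsRealization D φ R Q) (h : IsDilationFamily D φ m e) (i : FrameIndex j₀) :
    e i ∈ Q.range := by
  induction i using snoc_induction with
  | h0 => exact ⟨_, hQ.base.trans h.none_eq.symm⟩
  | h i j ih =>
    obtain ⟨n, hn⟩ := ih
    refine ⟨R.symm (tmul n (m j)), EquivLike.injective D ?_⟩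
    refine (hQ.intertwine _).trans ?_
    rw [InnerEquiv.apply_symm_apply, InnerMap.tensorId_tmul, h.apply_snoc]
    exact congrArg (tmul · (m j)) hn

theorem isParsevalFrame (hQ : IsRealization D φ R Q) (h : IsDilationFamily D φ m e)
    (hφ : X.inner φ φ = 1) (hframe : IsParsevalFrame (X := M.toRightHilbertModule) ⊤ m) :
    IsParsevalFrame Q.range e := by
  refine ⟨hQ.mem_range h, ?_⟩
  rintro _ ⟨z, rfl⟩
  refine SatisfiesParseval.of_dense (f := Q) (fun z => ?_) z
  refine filterLimit_induction (p := (· ∈ closure {z | SatisfiesParseval e (Q z)}))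
    isClosed_closure (fun k x => subset_closure ?_) z
  have hlimit : Q (filterLimitMap M (m j₀) hm k x) = realizationMap D φ hφ k x :=
    DFunLike.congr_fun (hQ.comp_filterLimitMap hφ k) x
  rw [Set.mem_ofPred_eq, hlimit]
  exact h.satisfiesParseval_realizationMap hφ hm hframe k x

theorem isOrthonormalModuleBasis (hQ : IsRealization D φ R Q) (h : IsDilationFamily D φ m e)
    (hφ : X.inner φ φ = 1) (hframe : IsParsevalFrame (X := M.toRightHilbertModule) ⊤ m)
    (horth : IsOrthonormalFamily (X := M.toRightHilbertModule) m) :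
    IsOrthonormalModuleBasis Q.range e :=
  have he := h.isOrthonormalFamily hφ horth
  ⟨he, hQ.mem_range h, fun y hy =>
    he.mem_closure_span ((hQ.isParsevalFrame h hφ hframe).2 y hy)⟩

end IsRealization

lemma InnerEquiv.tensorId_symm_tmul {Y : RightHilbertModule A} (U : InnerEquiv X Y) (y : Y)
    (n : M) : (U.tensorId M).symm (tmul y n) = tmul (U.symm y) n := by
  refine EquivLike.injective (U.tensorId M) ?_
  refine (InnerEquiv.apply_symm_apply _ _).trans (Eq.trans ?_ (U.tensorId_tmul M _ _).symm)
  rw [InnerEquiv.apply_symm_apply]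

lemma InnerEquiv.apply_dilationPow_succ_symm_tmul (D : InnerEquiv X (X.tensor M)) (k : ℕ)
    (z : X.tensorPow M k) (n : M) :
    D ((D.dilationPow (k + 1)).symm (tmul z n)) = tmul ((D.dilationPow k).symm z) n :=
  (D.apply_symm_apply _).trans ((D.dilationPow k).tensorId_symm_tmul z n)

lemma isDilationFamily_frameVector (hD : D φ = tmul φ (m j₀)) :
    IsDilationFamily D φ m (frameVector D φ j₀ m) where
  none_eq := rfl
  apply_snoc i j := by
    rcases i with _ | ⟨k, i, hi⟩
    · by_cases h : j = j₀
      · subst h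
        rw [snoc_none_self]
        exact hD
      · rw [snoc_none_of_ne h]
        exact D.apply_dilationPow_succ_symm_tmul 0 φ (m j)
    · refine (D.apply_dilationPow_succ_symm_tmul (k + 1) _ _).trans ?_
      change tmul ((D.dilationPow (k + 1)).symm (tprod φ fun l : Fin (k + 1) =>
        m (Fin.snoc (α := fun _ => J) i j l.castSucc)))
        (m (Fin.snoc (α := fun _ => J) i j (Fin.last (k + 1)))) = _
      simp only [Fin.snoc_castSucc, Fin.snoc_last]
      rfl

end DilationFamily

section TransferDilation

variable {A : Type u} [CStarAlgebra A] [PartialOrder A] {α : A →⋆ₐ[ℂ] A} {L : TransferOperator α}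
  {X : RightHilbertModule A} {D : X ≃ₗ[ℂ] X}

lemma IsTransferDilation.iterate_symm_op_smul (hD : IsTransferDilation L D) (k : ℕ) (x : X)
    (a : A) : D.symm^[k] (x <• α^[k] a) = D.symm^[k] x <• a := by
  induction k generalizing x with
  | zero => rfl
  | succ k ih =>
    have hsymm : D.symm (x <• α (α^[k] a)) = D.symm x <• α^[k] a := by
      rw [LinearEquiv.symm_apply_eq, hD.map_smul, LinearEquiv.apply_symm_apply]
    rw [Function.iterate_succ_apply, Function.iterate_succ_apply' α, hsymm, ih,
      Function.iterate_succ_apply]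

end TransferDilation

section TransferTensor

variable {A : Type u} [CStarAlgebra A] [PartialOrder A] [StarOrderedRing A]

lemma RightHilbertModule.op_smul_tmul {X : RightHilbertModule A} {M : CStarCorrespondence A}
    (x : X) (a : A) (m : M) : (tmul (x <• a) m : X.tensor M) = tmul x (a • m) := by
  refine ext_inner_left fun z => ?_
  refine tensor_induction (p := fun z => (X.tensor M).inner z (tmul (x <• a) m) =
    (X.tensor M).inner z (tmul x (a • m))) (isClosed_eq
      (continuous_inner continuous_id continuous_const)
      (continuous_inner continuous_id continuous_const)) (fun z w hz hw => ?_) (fun y n => ?_) z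
  · exact ((X.tensor M).pre.inner_add_left z w _).trans ((congrArg₂ (· + ·) hz hw).trans
      ((X.tensor M).pre.inner_add_left z w _).symm)
  · rw [inner_tmul_right, inner_tmul_right, X.inner_smul_right, mul_smul]

lemma RightHilbertModule.complex_smul_tmul {X : RightHilbertModule A} {M : CStarCorrespondence A}
    (c : ℂ) (x : X) (m : M) : (tmul (c • x) m : X.tensor M) = c • tmul x m := by
  rw [PreHilbertModule.complex_smul_eq (A := A) c (tmul x m), ← tmul_smul,
    ← PreHilbertModule.complex_smul_eq (A := A) c m,
    PreHilbertModule.complex_smul_eq (A := A) c x, op_smul_tmul, smul_assoc, one_smul]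

variable {α : A →⋆ₐ[ℂ] A} (L : TransferOperator α)

lemma TransferOperator.denseRange_toM : DenseRange L.toM :=
  UniformSpace.Completion.denseRange_coe (α := L.pre.toPreHilbertModule.Space)

lemma TransferOperator.smul_toM (a b : A) : a • L.toM b = L.toM (a * b) :=
  (UniformSpace.Completion.coe_smul (X := L.pre.toPreHilbertModule.Space) a b).symm

lemma TransferOperator.toM_op_smul (a b : A) : L.toM a <• b = L.toM (a * α b) :=
  (UniformSpace.Completion.coe_smul (X := L.pre.toPreHilbertModule.Space)
    (MulOpposite.op b) a).symm

variable (X : RightHilbertModule A)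

lemma TransferOperator.op_smul_tmul_one (x : X) (a : A) :
    (tmul (x <• a) (L.toM 1) : X.tensor L.correspondence) = tmul x (L.toM a) := by
  rw [op_smul_tmul, L.smul_toM, mul_one]

lemma TransferOperator.inner_tmul_one (x y : X) :
    (X.tensor L.correspondence).inner (tmul x (L.toM 1)) (tmul y (L.toM 1)) =
      L.toLinearMap (X.inner x y) := by
  rw [inner_tmul_right, L.smul_toM, L.inner_toM, star_one, one_mul, mul_one]

/-- The map `X_L → X ⊗_A M_L`, `x ↦ x ⊗ 1`. -/
def TransferOperator.tmulOne : X →ₗ[ℂ] X.tensor L.correspondence where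
  toFun x := tmul x (L.toM 1)
  map_add' x y := add_tmul x y _
  map_smul' c x := complex_smul_tmul c x _

/-- `L` is bounded below on positive elements. This makes `x ↦ x ⊗ 1` bounded below, hence
bijective. -/
def TransferOperator.IsBoundedBelow : Prop :=
  ∃ K : ℝ, 0 ≤ K ∧ ∀ a : A, 0 ≤ a → ‖a‖ ≤ K * ‖L.toLinearMap a‖

variable {L}

lemma TransferOperator.IsBoundedBelow.exists_norm_le_tmulOne (hL : L.IsBoundedBelow) :
    ∃ K : ℝ, 0 ≤ K ∧ ∀ x : X, ‖x‖ ≤ K * ‖L.tmulOne X x‖ := by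
  obtain ⟨K, hK0, hK⟩ := hL
  refine ⟨√K, Real.sqrt_nonneg _, fun x => ?_⟩
  rw [X.norm_eq, (X.tensor L.correspondence).norm_eq, ← Real.sqrt_mul hK0]
  refine Real.sqrt_le_sqrt ((hK _ (X.inner_self_nonneg x)).trans_eq ?_)
  exact congrArg (K * ‖·‖) (L.inner_tmul_one X x x).symm

lemma TransferOperator.IsBoundedBelow.bijective_tmulOne (hL : L.IsBoundedBelow) :
    Function.Bijective (L.tmulOne X) := by
  obtain ⟨K, hK0, hK⟩ := hL.exists_norm_le_tmulOne X
  have hanti : AntilipschitzWith ⟨K, hK0⟩ (L.tmulOne X) :=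
    AddMonoidHomClass.antilipschitz_of_bound _ hK
  refine ⟨hanti.injective, ?_⟩
  have hu : UniformContinuous (L.tmulOne X) :=
    uniformContinuous_addMonoidHom_of_continuous (f := (L.tmulOne X).toAddMonoidHom)
      (continuous_tmul_left _)
  have hcl : IsClosed (Set.range (L.tmulOne X)) := hanti.isClosed_range hu
  refine tensor_induction (p := fun z => z ∈ Set.range (L.tmulOne X)) hcl ?_ fun x n => ?_
  · rintro _ _ ⟨z, rfl⟩ ⟨w, rfl⟩
    exact ⟨z + w, map_add _ _ _⟩
  · refine L.denseRange_toM.induction_on (p := fun n => tmul x n ∈ Set.range (L.tmulOne X)) n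
      (hcl.preimage (continuous_tmul_right x)) fun a => ⟨x <• a, L.op_smul_tmul_one X x a⟩

/-- The isomorphism of `X_L` onto `X ⊗_A M_L`, `x ↦ x ⊗ 1`. -/
def TransferOperator.IsBoundedBelow.tmulEquiv (hL : L.IsBoundedBelow) :
    X ≃ₗ[ℂ] X.tensor L.correspondence :=
  LinearEquiv.ofBijective (L.tmulOne X) (hL.bijective_tmulOne X)

lemma TransferOperator.IsBoundedBelow.tmulEquiv_apply (hL : L.IsBoundedBelow) (x : X) :
    hL.tmulEquiv X x = tmul x (L.toM 1) := rfl

lemma TransferOperator.IsBoundedBelow.tmulEquiv_op_smul (hL : L.IsBoundedBelow) (x : X) (a : A) :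
    hL.tmulEquiv X (x <• a) = tmul x (L.toM a) := L.op_smul_tmul_one X x a

lemma TransferOperator.IsBoundedBelow.tmulEquiv_op_smul_map (hL : L.IsBoundedBelow) (x : X)
    (a : A) : hL.tmulEquiv X (x <• α a) = hL.tmulEquiv X x <• a := by
  rw [hL.tmulEquiv_op_smul, hL.tmulEquiv_apply, ← tmul_smul, L.toM_op_smul, one_mul]

variable {X}

lemma tensor_toM_ext {Y : RightHilbertModule A} {f g : InnerMap (X.tensor L.correspondence) Y}
    (h : ∀ x a, f (tmul x (L.toM a)) = g (tmul x (L.toM a))) : f = g :=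
  tensor_ext fun x => congrFun <| L.denseRange_toM.equalizer
    (f.continuous.comp (continuous_tmul_right x)) (g.continuous.comp (continuous_tmul_right x))
    (funext (h x))

/-- The isomorphism `X → X ⊗_A M_L`, `x ↦ D x ⊗ 1`, defined by a dilation `D` of `X`. -/
def IsTransferDilation.toTensor {D : X ≃ₗ[ℂ] X} (hD : IsTransferDilation L D)
    (hL : L.IsBoundedBelow) : InnerEquiv X (X.tensor L.correspondence) where
  toLinearEquiv :=
    { D.trans (hL.tmulEquiv X) with
      map_smul' := fun a x => by
        change hL.tmulEquiv X (D (x <• a.unop)) = hL.tmulEquiv X (D x) <• a.unop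
        rw [hD.map_smul, hL.tmulEquiv_op_smul_map] }
  inner_map x y := (L.inner_tmul_one X (D x) (D y)).trans (hD.inner_map x y)

lemma IsTransferDilation.toTensor_apply {D : X ≃ₗ[ℂ] X} (hD : IsTransferDilation L D)
    (hL : L.IsBoundedBelow) (x : X) : hD.toTensor hL x = tmul (D x) (L.toM 1) := rfl

/-- The dilation `D` of `X` defined by an isomorphism `U : X → X ⊗_A M_L`, such that
`U x = D x ⊗ 1`. -/
def InnerEquiv.toDilation (U : InnerEquiv X (X.tensor L.correspondence))
    (hL : L.IsBoundedBelow) : X ≃ₗ[ℂ] X :=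
  LinearEquiv.trans
    ({ U.toLinearEquiv with map_smul' := fun c x => U.toInnerMap.map_complex_smul c x } :
      X ≃ₗ[ℂ] X.tensor L.correspondence)
    (hL.tmulEquiv X).symm

lemma InnerEquiv.tmulEquiv_toDilation (U : InnerEquiv X (X.tensor L.correspondence))
    (hL : L.IsBoundedBelow) (x : X) : hL.tmulEquiv X (U.toDilation hL x) = U x :=
  (hL.tmulEquiv X).apply_symm_apply _

lemma InnerEquiv.isTransferDilation_toDilation (U : InnerEquiv X (X.tensor L.correspondence))
    (hL : L.IsBoundedBelow) : IsTransferDilation L (U.toDilation hL) where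
  map_smul x a := by
    refine (hL.tmulEquiv X).injective ?_
    rw [hL.tmulEquiv_op_smul_map, U.tmulEquiv_toDilation, U.tmulEquiv_toDilation]
    exact map_smul U.toInnerMap _ _
  inner_map x y := by
    rw [← L.inner_tmul_one, ← hL.tmulEquiv_apply, ← hL.tmulEquiv_apply,
      U.tmulEquiv_toDilation, U.tmulEquiv_toDilation]
    exact U.inner_map x y

variable {m : L.correspondence} {hm : L.correspondence.inner m m = 1} {D : X ≃ₗ[ℂ] X} {φ : X}

lemma IsTransferRealization.isRealization (hL : L.IsBoundedBelow) (hD : IsTransferDilation L D)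
    {R : filterLimit L.correspondence m hm ≃ₗ[ℂ] filterLimit L.correspondence m hm}
    {Q : InnerMap (filterLimit L.correspondence m hm) X} (h : IsTransferRealization D φ R Q) :
    IsRealization (hD.toTensor hL) φ (h.dilation.toTensor hL) Q where
  shift k := DFunLike.congr_fun <| tensor_toM_ext
    (f := (h.dilation.toTensor hL).toInnerMap.comp (filterLimitMap L.correspondence m hm (k + 1)))
    fun z a => by
      rw [InnerMap.tensorId_tmul]
      exact (congrArg (tmul · (L.toM 1)) (h.shift k z a)).trans (L.op_smul_tmul_one _ _ _)
  base := h.base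
  intertwine z := by
    rw [hD.toTensor_apply, h.dilation.toTensor_apply, InnerMap.tensorId_tmul, h.intertwine]

lemma IsRealization.isTransferRealization (hL : L.IsBoundedBelow) (hD : IsTransferDilation L D)
    {R : InnerEquiv (filterLimit L.correspondence m hm)
      ((filterLimit L.correspondence m hm).tensor L.correspondence)}
    {Q : InnerMap (filterLimit L.correspondence m hm) X}
    (h : IsRealization (hD.toTensor hL) φ R Q) :
    IsTransferRealization D φ (R.toDilation hL) Q where
  dilation := R.isTransferDilation_toDilation hL
  shift k z a := by
    refine (hL.tmulEquiv _).injective ?_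
    rw [R.tmulEquiv_toDilation, hL.tmulEquiv_op_smul]
    exact (h.shift k (tmul z (L.toM a))).trans (InnerMap.tensorId_tmul _ _ _ _)
  base := h.base
  intertwine z := by
    refine (hL.tmulEquiv X).injective ?_
    refine (h.intertwine z).trans ?_
    rw [← R.tmulEquiv_toDilation hL, hL.tmulEquiv_apply, InnerMap.tensorId_tmul]
    rfl

theorem IsTransferDilation.existsUnique_isTransferRealization (hL : L.IsBoundedBelow)
    (hD : IsTransferDilation L D) (hφ : IsScalingFunction m (hD.toTensor hL) φ) :
    ∃! p : (filterLimit L.correspondence m hm ≃ₗ[ℂ] filterLimit L.correspondence m hm) ×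
      InnerMap (filterLimit L.correspondence m hm) X, IsTransferRealization D φ p.1 p.2 := by
  obtain ⟨⟨R, Q⟩, hRQ, huniq⟩ := existsUnique_isRealization (hm := hm) hφ
  refine ⟨(R.toDilation hL, Q), hRQ.isTransferRealization hL hD, fun p hp => ?_⟩
  have h := huniq (hp.dilation.toTensor hL, p.2) (hp.isRealization hL hD)
  have h1 : hp.dilation.toTensor hL = R := congrArg Prod.fst h
  have h2 : p.2 = Q := congrArg Prod.snd h
  refine Prod.ext (LinearEquiv.ext fun z => (hL.tmulEquiv _).injective ?_) h2
  rw [R.tmulEquiv_toDilation, ← h1]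
  rfl

lemma IsTransferDilation.isScalingFunction (hD : IsTransferDilation L D) (hL : L.IsBoundedBelow)
    {a : A} (hφ : X.inner φ φ = 1) (hDφ : D φ = φ <• a) :
    IsScalingFunction (L.toM a) (hD.toTensor hL) φ :=
  ⟨hφ, by rw [hD.toTensor_apply, hDφ, L.op_smul_tmul_one]⟩

end TransferTensor

section CommutativeTransfer

open FrameIndex

lemma isDilationFamily_transferFrameVector {C : Type u} [TopologicalSpace C] [CompactSpace C]
    {α : C(C, ℂ) →⋆ₐ[ℂ] C(C, ℂ)} {L : TransferOperator α} {X : RightHilbertModule C(C, ℂ)}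
    {D : X ≃ₗ[ℂ] X} {φ : X} {J : Type*} {j₀ : J} {m : J → C(C, ℂ)}
    (hD : IsTransferDilation L D) (hL : L.IsBoundedBelow) (hφ : D φ = φ <• m j₀) :
    IsDilationFamily (hD.toTensor hL) φ (fun j => L.toM (m j))
      (transferFrameVector α D φ j₀ m) where
  none_eq := rfl
  apply_snoc i j := by
    refine (congrArg (tmul · (L.toM 1)) ?_).trans (L.op_smul_tmul_one X _ _)
    rcases i with _ | ⟨k, i, hi⟩
    · by_cases h : j = j₀
      · subst h
        rw [snoc_none_self]
        exact hφ
      · rw [snoc_none_of_ne h]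
        change D (D.symm (φ <• ∏ l : Fin 1, α^[(l : ℕ)] (m j))) = φ <• m j
        rw [LinearEquiv.apply_symm_apply, Fin.prod_univ_one]
        rfl
    · change D (D.symm^[k + 1 + 1] (φ <• ∏ l : Fin (k + 1 + 1),
        α^[(l : ℕ)] (m (Fin.snoc (α := fun _ => J) i j l)))) =
        D.symm^[k + 1] (φ <• ∏ l : Fin (k + 1), α^[(l : ℕ)] (m (i l))) <• m j
      rw [Function.iterate_succ_apply', LinearEquiv.apply_symm_apply, Fin.prod_univ_castSucc,
        ← hD.iterate_symm_op_smul, smul_smul, ← MulOpposite.op_mul]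
      simp only [Fin.snoc_castSucc, Fin.snoc_last, Fin.val_castSucc, Fin.val_last]

end CommutativeTransfer

section LocalHomeomorphism

open Set

lemma exists_card_fibre_le_of_isLocallyInjective {X Y : Type*} [TopologicalSpace X]
    [CompactSpace X] {f : X → Y} (hf : IsLocallyInjective f) :
    ∃ n : ℕ, ∀ y, Nat.card (f ⁻¹' {y}) ≤ n := by
  choose U hUo hxU hinj using hf
  obtain ⟨s, hs⟩ := isCompact_univ.elim_finite_subcover U hUo fun x _ => mem_iUnion.2 ⟨x, hxU x⟩
  refine ⟨s.card, fun y => ?_⟩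
  have hcover (x : f ⁻¹' {y}) : ∃ i : s, x.1 ∈ U i := by
    obtain ⟨i, hi, hx⟩ := mem_iUnion₂.1 (hs (mem_univ x.1))
    exact ⟨⟨i, hi⟩, hx⟩
  choose g hg using hcover
  have hginj : Function.Injective g := fun x x' h =>
    Subtype.ext (hinj (g x) (hg x) (h ▸ hg x') (x.2.trans x'.2.symm))
  exact (Nat.card_le_card_of_injective g hginj).trans_eq (by simp)

variable {C : Type u} [TopologicalSpace C] [CompactSpace C] [T2Space C] {σ : C(C, C)}

lemma le_card_fibre_mul_averagingTransfer (hσ : IsLocalHomeomorph σ) {f : C(C, ℂ)} (hf : 0 ≤ f)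
    (d : C) : f d ≤ Nat.card (σ ⁻¹' {σ d}) * (averagingTransfer σ hσ).toLinearMap f (σ d) := by
  have hfin := finite_fibre hσ (σ d)
  have := Fintype.ofFinite (σ ⁻¹' {σ d})
  have : Nonempty (σ ⁻¹' {σ d}) := ⟨⟨d, rfl⟩⟩
  calc f d ≤ ∑ i : σ ⁻¹' {σ d}, f i :=
        Finset.single_le_sum (f := fun i : σ ⁻¹' {σ d} => f i)
          (fun i _ => ContinuousMap.le_def.1 hf i) (Finset.mem_univ ⟨d, rfl⟩)
    _ = Nat.card (σ ⁻¹' {σ d}) * fibreAverage σ f (σ d) := by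
        rw [fibreAverage, finsum_eq_sum_of_fintype, mul_inv_cancel_left₀]
        exact_mod_cast Nat.card_pos.ne'

lemma isBoundedBelow_averagingTransfer (hσ : IsLocalHomeomorph σ) :
    (averagingTransfer σ hσ).IsBoundedBelow := by
  obtain ⟨n, hn⟩ := exists_card_fibre_le_of_isLocallyInjective hσ.isLocallyInjective
  refine ⟨n, Nat.cast_nonneg n, fun f hf => ?_⟩
  rw [ContinuousMap.norm_le _ (by positivity)]
  intro d
  calc ‖f d‖ ≤ ‖Nat.card (σ ⁻¹' {σ d}) * (averagingTransfer σ hσ).toLinearMap f (σ d)‖ :=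
        CStarAlgebra.norm_le_norm_of_nonneg_of_le (ContinuousMap.le_def.1 hf d)
          (le_card_fibre_mul_averagingTransfer hσ hf d)
    _ = Nat.card (σ ⁻¹' {σ d}) * ‖(averagingTransfer σ hσ).toLinearMap f (σ d)‖ := by
        rw [norm_mul, Complex.norm_natCast]
    _ ≤ n * ‖(averagingTransfer σ hσ).toLinearMap f‖ := by
        gcongr
        · exact hn _
        · exact ContinuousMap.norm_coe_le_norm _ _

end LocalHomeomorphism

end

universe v

theorem mainTheorem7_general :
    (∀ (A : Type u) [CStarAlgebra A] [PartialOrder A] [StarOrderedRing A]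
        (M : CStarCorrespondence A) (J : Type v) (j₀ : J) (m : J → M)
        (hm : M.inner (m j₀) (m j₀) = 1)
        (X : RightHilbertModule A) (D : InnerEquiv X (X.tensor M)) (φ : X),
        IsParsevalFrame (X := M.toRightHilbertModule) ⊤ m →
        IsScalingFunction (m j₀) D φ →
        (∃! p : InnerEquiv (filterLimit M (m j₀) hm) ((filterLimit M (m j₀) hm).tensor M) ×
            InnerMap (filterLimit M (m j₀) hm) X, IsRealization D φ p.1 p.2) ∧
        ∀ (R : InnerEquiv (filterLimit M (m j₀) hm) ((filterLimit M (m j₀) hm).tensor M))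
          (Q : InnerMap (filterLimit M (m j₀) hm) X), IsRealization D φ R Q →
          IsParsevalFrame Q.range (frameVector D φ j₀ m) ∧
          (IsOrthonormalFamily (X := M.toRightHilbertModule) m →
            IsOrthonormalModuleBasis Q.range (frameVector D φ j₀ m))) ∧
    (∀ (C : Type u) [TopologicalSpace C] [CompactSpace C] (α : C(C, ℂ) →⋆ₐ[ℂ] C(C, ℂ))
        (L : TransferOperator α) (_ : L.IsBoundedBelow) (J : Type v) (j₀ : J) (m : J → C(C, ℂ))
        (hm : L.correspondence.inner (L.toM (m j₀)) (L.toM (m j₀)) = 1)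
        (X : RightHilbertModule C(C, ℂ)) (D : X ≃ₗ[ℂ] X) (φ : X),
        IsParsevalFrame (X := L.correspondence.toRightHilbertModule) ⊤ (fun j => L.toM (m j)) →
        X.inner φ φ = 1 →
        IsTransferDilation L D →
        D φ = φ <• m j₀ →
        (∃! p : (filterLimit L.correspondence (L.toM (m j₀)) hm ≃ₗ[ℂ]
            filterLimit L.correspondence (L.toM (m j₀)) hm) ×
            InnerMap (filterLimit L.correspondence (L.toM (m j₀)) hm) X,
          IsTransferRealization D φ p.1 p.2) ∧
        ∀ (R : filterLimit L.correspondence (L.toM (m j₀)) hm ≃ₗ[ℂ]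
            filterLimit L.correspondence (L.toM (m j₀)) hm)
          (Q : InnerMap (filterLimit L.correspondence (L.toM (m j₀)) hm) X),
          IsTransferRealization D φ R Q →
          IsParsevalFrame Q.range (transferFrameVector α D φ j₀ m) ∧
          (IsOrthonormalFamily (X := L.correspondence.toRightHilbertModule)
              (fun j => L.toM (m j)) →
            IsOrthonormalModuleBasis Q.range (transferFrameVector α D φ j₀ m))) := by
  constructor
  · intro A _ _ _ M J j₀ m hm X D φ hframe hφ
    have he := isDilationFamily_frameVector (j₀ := j₀) (m := m) hφ.apply_eq_tmul
    exact ⟨existsUnique_isRealization hφ, fun R Q h => ⟨h.isParsevalFrame he hφ.inner_self hframe,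
      h.isOrthonormalModuleBasis he hφ.inner_self hframe⟩⟩
  · intro C _ _ α L hL J j₀ m hm X D φ hframe hφ hD hDφ
    have he := isDilationFamily_transferFrameVector hD hL hDφ
    refine ⟨hD.existsUnique_isTransferRealization hL (hD.isScalingFunction hL hφ hDφ),
      fun R Q h => ?_⟩
    have hR := h.isRealization hL hD
    exact ⟨hR.isParsevalFrame (m := fun j => L.toM (m j)) he hφ hframe,
      hR.isOrthonormalModuleBasis (m := fun j => L.toM (m j)) he hφ hframe⟩

theorem mainTheorem7 :
    (∀ (A : Type u) [CStarAlgebra A] [PartialOrder A] [StarOrderedRing A]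
        (M : CStarCorrespondence A) (J : Type) [Countable J] (j₀ : J) (m : J → M)
        (hm : M.inner (m j₀) (m j₀) = 1)
        (X : RightHilbertModule A) (D : InnerEquiv X (X.tensor M)) (φ : X),
        IsParsevalFrame (X := M.toRightHilbertModule) ⊤ m →
        IsScalingFunction (m j₀) D φ →
        (∃! p : InnerEquiv (filterLimit M (m j₀) hm) ((filterLimit M (m j₀) hm).tensor M) ×
            InnerMap (filterLimit M (m j₀) hm) X, IsRealization D φ p.1 p.2) ∧
        ∀ (R : InnerEquiv (filterLimit M (m j₀) hm) ((filterLimit M (m j₀) hm).tensor M))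
          (Q : InnerMap (filterLimit M (m j₀) hm) X), IsRealization D φ R Q →
          IsParsevalFrame Q.range (frameVector D φ j₀ m) ∧
          (IsOrthonormalFamily (X := M.toRightHilbertModule) m →
            IsOrthonormalModuleBasis Q.range (frameVector D φ j₀ m))) ∧
    (∀ (C : Type u) [TopologicalSpace C] [CompactSpace C] [T2Space C] (σ : C(C, C))
        (hσ : IsLocalHomeomorph σ) (_ : Function.Surjective σ)
        (J : Type) [Countable J] (j₀ : J) (m : J → C(C, ℂ))
        (hm : (averagingTransfer σ hσ).correspondence.inner
          ((averagingTransfer σ hσ).toM (m j₀)) ((averagingTransfer σ hσ).toM (m j₀)) = 1)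
        (X : RightHilbertModule C(C, ℂ)) (D : X ≃ₗ[ℂ] X) (φ : X),
        IsParsevalFrame (X := (averagingTransfer σ hσ).correspondence.toRightHilbertModule) ⊤
          (fun j => (averagingTransfer σ hσ).toM (m j)) →
        X.inner φ φ = 1 →
        IsTransferDilation (averagingTransfer σ hσ) D →
        D φ = φ <• m j₀ →
        (∃! p : (filterLimit (averagingTransfer σ hσ).correspondence
              ((averagingTransfer σ hσ).toM (m j₀)) hm ≃ₗ[ℂ]
            filterLimit (averagingTransfer σ hσ).correspondence
              ((averagingTransfer σ hσ).toM (m j₀)) hm) ×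
            InnerMap (filterLimit (averagingTransfer σ hσ).correspondence
              ((averagingTransfer σ hσ).toM (m j₀)) hm) X,
          IsTransferRealization D φ p.1 p.2) ∧
        ∀ (R : filterLimit (averagingTransfer σ hσ).correspondence
              ((averagingTransfer σ hσ).toM (m j₀)) hm ≃ₗ[ℂ]
            filterLimit (averagingTransfer σ hσ).correspondence
              ((averagingTransfer σ hσ).toM (m j₀)) hm)
          (Q : InnerMap (filterLimit (averagingTransfer σ hσ).correspondence
              ((averagingTransfer σ hσ).toM (m j₀)) hm) X),
          IsTransferRealization D φ R Q →
          IsParsevalFrame Q.range (transferFrameVector (pullbackHom σ) D φ j₀ m) ∧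
          (IsOrthonormalFamily (X := (averagingTransfer σ hσ).correspondence.toRightHilbertModule)
              (fun j => (averagingTransfer σ hσ).toM (m j)) →
            IsOrthonormalModuleBasis Q.range
              (transferFrameVector (pullbackHom σ) D φ j₀ m))) := by
  refine ⟨fun A _ _ _ M J _ => mainTheorem7_general.1 A M J, fun C _ _ _ σ hσ _ J _ => ?_⟩
  exact mainTheorem7_general.2 C _ _ (isBoundedBelow_averagingTransfer hσ) J
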